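/- Let $\alpha\in[-1,1]\setminus\{0\}$, let $j_*\ge 1$ be an integer, and let $p\colon\mathbb R\to\mathbb R$ be $C^2$, even and strictly monotone on $[0,\infty)$, such that, for $|\xi|$ large, $|p(\xi)|\eqsim|\xi|^{\alpha}$, $|p'(\xi)|\eqsim|\xi|^{\alpha-1}$ and $|p''(\xi)|\lesssim|\xi|^{\alpha-2}$, and, for $|\xi|$ small, $p(\xi)=p(0)+\xi^{2j_*}\tilde p(\xi)$ with $\tilde p$ locally Lipschitz and $\tilde p(0)\neq0$. Write $\hat f(\xi)=\int_{\mathbb R} f(x)e^{-ix\xi}\,dx$, put $$m(a,b)=\frac{a+b}{2\,[\,p(a)a+p(b)b-p(a+b)(a+b)\,]},\qquad \widehat{B(f,g)}(\xi)=\int_{\mathbb R} m(\xi-\eta,\eta)\hat f(\xi-\eta)\hat g(\eta)\,d\eta ,$$ and define the modified energies $$E^{(k)}(u)=\|\partial_x^k u\|_{L^2}^2+2\big(\partial_x^k u,\partial_x^k B(u,u)\big)_{L^2}.$$ Since $m$ is singular at $a=0$ and at $b=0$ and grows at infinity, $E^{(k)}(u)$ is understood as a principal value: it is the limit as $\varepsilon\downarrow0$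 of the same expression with $m(a,b)$ replaced by $0$ unless $|a|$, $|b|$ and $|a+b|$ all lie in $(\varepsilon,1/\varepsilon)$. Let $N\ge\max\{2,2j_*-1\}$, let $\|u\|_{H^N}^2=\sum_{k=0}^N\|\partial_x^k u\|_{L^2}^2$, and put $$|||u|||_N^2=\|u\|_{L^2}^2+\sum_{k=2j_*-1}^N\|\partial_x^k u\|_{L^2}^2 .$$ Then there is a constant $C>0$, depending only on $p$, $\alpha$, $j_*$ and $N$, such that for every real-valued $u\in H^N(\mathbb R)$ (in particular for $u=u(t,\cdot)$ at any time $t$ of a solution of $\partial_tu+u\partial_xu-\mathcal L\partial_xu=0$ with values in $H^N(\mathbb R)$, where $\mathcal L$ is the Fourier multiplier with symbol $p$): 1. for $2j_*-1\le k\le N$ the limit defining $E^{(k)}(u)$ exists; and if $B(u,u)$ and $\partial_x^kB(u,u)$ lie in $L^2$ and the double integral in $(\xi,\eta)$ that expresses $(\partial_x^k u,\partial_x^k B(u,u))_{L^2}$ on the Fourier side converges absolutely, then the principal value agrees with the expression without truncation; 2. $\displaystyle\Big|\sum_{k=2j_*-1}^N E^{(k)}(u)+\|u\|_{L^2}^2-|||u|||_N^2\Big|\le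 C\,\|u\|_{H^2}\,|||u|||_N^2$, that is, $\sum_{k=2j_*-1}^N E^{(k)}(u)+\|u\|_{L^2}^2=\big(1+\mathcal O(\|u\|_{H^2})\big)|||u|||_N^2$; 3. $|||u|||_N\le\|u\|_{H^N}\le C\,|||u|||_N$, so that $|||\cdot|||_N$ is an equivalent norm of $H^N(\mathbb R)$ (and it equals $\|\cdot\|_{H^N}$ if $j_*=1$). -/

import Mathlib

open MeasureTheory Filter Topology
open scoped FourierTransform ComplexConjugate SchwartzMap

noncomputable section

namespace Whitham

/-- The complex Hilbert space `L²(ℝ)`. -/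
abbrev L2 : Type := Lp (α := ℝ) ℂ 2

/-- The assumptions on the symbol `p` of the dispersive operator, with order `α` at infinity and an
extremum of order `2 j` at the origin. The second derivative is only asked to satisfy the upper bound
`|p''(ξ)| ≲ |ξ| ^ (α - 2)`, so that `α = 1` is possible (for instance `p(ξ) = √(1 + ξ²)`). -/
structure IsSymbol (p : ℝ → ℝ) (α : ℝ) (j : ℕ) : Prop where
  contDiff : ContDiff ℝ 2 p
  even : ∀ ξ, p (-ξ) = p ξ
  strictMonotone : StrictMonoOn p (Set.Ici 0) ∨ StrictAntiOn p (Set.Ici 0)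
  farField : ∃ c > 0, ∃ C > 0, ∃ R > 0, ∀ ξ : ℝ, R ≤ |ξ| →
    (c * |ξ| ^ α ≤ |p ξ| ∧ |p ξ| ≤ C * |ξ| ^ α) ∧
    (c * |ξ| ^ (α - 1) ≤ |deriv p ξ| ∧ |deriv p ξ| ≤ C * |ξ| ^ (α - 1)) ∧
    |iteratedDeriv 2 p ξ| ≤ C * |ξ| ^ (α - 2)
  nearField : ∃ q : ℝ → ℝ, LocallyLipschitz q ∧ q 0 ≠ 0 ∧
    ∃ δ > 0, ∀ ξ : ℝ, |ξ| < δ → p ξ = p 0 + ξ ^ (2 * j) * q ξ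

/-- The Fourier transform of `f ∈ L²(ℝ)` in the normalization `∫ f(x) exp (-i x ξ) dx`; Mathlib's
transform `𝓕` has `exp (-2 π i x ζ)`. -/
def hat (f : L2) (ξ : ℝ) : ℂ := (𝓕 f : L2) (ξ / (2 * Real.pi))

open Classical in
/-- The element of `L²(ℝ)` whose transform `hat` is `g`, for square-integrable `g` (and `0` if `g`
is not square-integrable). -/
def ofHat (g : ℝ → ℂ) : L2 :=
  if h : MemLp (fun ζ : ℝ => g (2 * Real.pi * ζ)) 2 volume then 𝓕⁻ (h.toLp _ : L2) else 0

/-- The derivative `∂ₓᵏ f`, that is, the Fourier multiplier `(i ξ)ᵏ`. -/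
def dx (k : ℕ) (f : L2) : L2 := ofHat fun ξ => (Complex.I * ξ) ^ k * hat f ξ

/-- The real functions in the Sobolev space `Hᴺ(ℝ)`. -/
def IsRealSobolev (N : ℕ) (u : L2) : Prop :=
  (∀ᵐ x : ℝ, (u x).im = 0) ∧ TemperedDistribution.MemSobolev (N : ℝ) 2 (u : 𝓢'(ℝ, ℂ))

/-- The Sobolev norm, `‖u‖_{Hᴺ}² = ∑_{k=0}^N ‖∂ₓᵏ u‖²`. -/
def sobolevNorm (N : ℕ) (u : L2) : ℝ := √(∑ k ∈ Finset.range (N + 1), ‖dx k u‖ ^ 2)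

/-- The Sobolev norm in which the derivatives of orders `1, …, 2 j - 2` are left out,
`‖u‖² + ∑_{k=2j-1}^N ‖∂ₓᵏ u‖²`. For `j = 1` it is `sobolevNorm N`. -/
def energyNorm (j N : ℕ) (u : L2) : ℝ :=
  √(‖u‖ ^ 2 + ∑ k ∈ Finset.Icc (2 * j - 1) N, ‖dx k u‖ ^ 2)

/-- The multiplier `m(a, b)` of the normal form. -/
def mult (p : ℝ → ℝ) (a b : ℝ) : ℝ :=
  (a + b) / (2 * (p a * a + p b * b - p (a + b) * (a + b)))

open Classical in
/-- The multiplier `m` restricted to the frequencies with `ε < |a|, |b|, |a + b| < 1 / ε`. -/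
def truncMult (p : ℝ → ℝ) (ε a b : ℝ) : ℝ :=
  if (ε < |a| ∧ |a| < 1 / ε) ∧ (ε < |b| ∧ |b| < 1 / ε) ∧ (ε < |a + b| ∧ |a + b| < 1 / ε)
  then mult p a b else 0

/-- The transform of the pseudo-product of `f` and `g` with multiplier `μ`. -/
def pseudoHat (μ : ℝ → ℝ → ℝ) (f g : L2) (ξ : ℝ) : ℂ :=
  ∫ η : ℝ, (μ (ξ - η) η : ℂ) * hat f (ξ - η) * hat g η

/-- The pseudo-product of `f` and `g` with multiplier `μ`. -/
def pseudoProd (μ : ℝ → ℝ → ℝ) (f g : L2) : L2 := ofHat (pseudoHat μ f g)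

/-- `‖∂ₓᵏ u‖² + 2 (∂ₓᵏ u, ∂ₓᵏ B(u, u))₂`, where `B` is the pseudo-product with multiplier `μ`. -/
def energyWith (μ : ℝ → ℝ → ℝ) (k : ℕ) (u : L2) : ℝ :=
  ‖dx k u‖ ^ 2 + 2 * (inner ℂ (dx k u) (dx k (pseudoProd μ u u))).re

/-- The modified energy `‖∂ₓᵏ u‖² + 2 (∂ₓᵏ u, ∂ₓᵏ B(u, u))₂`. The multiplier `m` of `B` is singular at
`a = 0` and `b = 0`, like `1 / a` and `1 / b`, and grows at infinity, so that for a general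
`u ∈ Hᴺ` the integrals do not converge absolutely: the energy is their principal value. -/
def modifiedEnergy (p : ℝ → ℝ) (k : ℕ) (u : L2) : ℝ :=
  limUnder (𝓝[>] (0 : ℝ)) fun ε => energyWith (truncMult p ε) k u

/-- `B(u, u)` and `∂ₓᵏ B(u, u)` are in `L²` and the double integral for `(∂ₓᵏ u, ∂ₓᵏ B(u, u))₂`
converges absolutely, so that no principal value is needed. -/
def ConvergesAbsolutely (p : ℝ → ℝ) (k : ℕ) (u : L2) : Prop :=
  MemLp (pseudoHat (mult p) u u) 2 volume ∧
  MemLp (fun ξ : ℝ => (Complex.I * ξ) ^ k * pseudoHat (mult p) u u ξ) 2 volume ∧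
  Integrable (fun z : ℝ × ℝ => (z.1 : ℂ) ^ (2 * k) * conj (hat u z.1) *
    ((mult p (z.1 - z.2) z.2 : ℂ) * hat u (z.1 - z.2) * hat u z.2)) volume

end Whitham

end

/-!
On the Fourier side `(∂ₓᵏ u, ∂ₓᵏ B(u, u))` is the integral of `(a + b) ^ (2 k) * m(a, b)` against
the cubic form `û(a) û(b) û(-(a + b))`, over the frequencies `a`, `b`, `-(a + b)` of sum zero. The
denominator of `m` and the truncation are invariant under permutations of these frequencies.
Averaging over the choice of the distinguished frequency therefore replaces the numerator
`(a + b) ^ (2 k + 1)` by a multiple of `a ^ (2 k + 1) + b ^ (2 k + 1) - (a + b) ^ (2 k + 1)`.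
This is at most a multiple of the smallest frequency times the `2 k`-th power of the largest one,
which compensates for the zeros of the denominator: the quotient is bounded by a weight that puts
one derivative on one factor and `k` derivatives on each of the others. The symmetrized integral
converges absolutely by an `L¹ × L² × L²` estimate, in which the `L¹` factor is controlled by
`‖u‖_{H²}`.
-/

noncomputable section

namespace Whitham

/-! ### The Fourier transform of an element of `L²` -/

section Conjugation

variable {V : Type*} [NormedAddCommGroup V] [InnerProductSpace ℝ V] [FiniteDimensional ℝ V]
  [MeasurableSpace V] [BorelSpace V]

theorem fourier_postcomp_conj (f : 𝓢(V, ℂ)) (ξ : V) :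
    𝓕 (SchwartzMap.postcompCLM (Complex.conjCLE : ℂ →L[ℝ] ℂ) f) ξ = conj (𝓕 f (-ξ)) := by
  simp only [SchwartzMap.fourier_coe, Real.fourier_eq', SchwartzMap.postcompCLM_apply,
    ContinuousLinearEquiv.coe_coe, Complex.conjCLE_apply, ← integral_conj, smul_eq_mul, map_mul,
    ← Complex.exp_conj, Complex.conj_I, inner_neg_right, mul_neg, Complex.ofReal_neg,
    Complex.conj_ofReal, neg_mul, neg_neg]

theorem fourier_compLp_conj_toLp (f : 𝓢(V, ℂ)) :
    𝓕 ((Complex.conjCLE : ℂ →L[ℝ] ℂ).compLp (f.toLp 2)) =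
      (Complex.conjCLE : ℂ →L[ℝ] ℂ).compLp (Lp.compMeasurePreserving _
        (Measure.measurePreserving_neg (volume : Measure V)) (𝓕 (f.toLp 2))) := by
  have compLp_toLp : (Complex.conjCLE : ℂ →L[ℝ] ℂ).compLp (f.toLp 2) =
      (SchwartzMap.postcompCLM (Complex.conjCLE : ℂ →L[ℝ] ℂ) f).toLp 2 := by
    ext1
    filter_upwards [(Complex.conjCLE : ℂ →L[ℝ] ℂ).coeFn_compLp (f.toLp 2), f.coeFn_toLp 2,
      (SchwartzMap.postcompCLM (Complex.conjCLE : ℂ →L[ℝ] ℂ) f).coeFn_toLp 2] with x h₁ h₂ h₃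
    rw [h₁, h₂, h₃, SchwartzMap.postcompCLM_apply]
  rw [compLp_toLp, SchwartzMap.toLp_fourier_eq, SchwartzMap.toLp_fourier_eq]
  have hneg := Measure.measurePreserving_neg (volume : Measure V)
  ext1
  filter_upwards [(Complex.conjCLE : ℂ →L[ℝ] ℂ).coeFn_compLp
      (Lp.compMeasurePreserving _ hneg ((𝓕 f).toLp 2)),
    Lp.coeFn_compMeasurePreserving ((𝓕 f).toLp 2) hneg,
    hneg.quasiMeasurePreserving.ae ((𝓕 f).coeFn_toLp 2 volume),
    (𝓕 (SchwartzMap.postcompCLM (Complex.conjCLE : ℂ →L[ℝ] ℂ) f)).coeFn_toLp 2] with ξ h₁ h₂ h₃ h₄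
  rw [h₁, h₂, h₄, fourier_postcomp_conj, Function.comp_apply, h₃]
  rfl

theorem fourier_compLp_conj (f : Lp (α := V) ℂ 2) :
    𝓕 ((Complex.conjCLE : ℂ →L[ℝ] ℂ).compLp f) =
      (Complex.conjCLE : ℂ →L[ℝ] ℂ).compLp (Lp.compMeasurePreserving _
        (Measure.measurePreserving_neg (volume : Measure V)) (𝓕 f)) := by
  have hfourier : Continuous fun g : Lp (α := V) ℂ 2 => 𝓕 g :=
    (Lp.fourierTransformₗᵢ V ℂ).continuous
  have hconj : Continuous fun g : Lp (α := V) ℂ 2 => (Complex.conjCLE : ℂ →L[ℝ] ℂ).compLp g :=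
    ((Complex.conjCLE : ℂ →L[ℝ] ℂ).compLpL 2 volume).continuous
  have hneg := (Lp.isometry_compMeasurePreserving (E := ℂ) (p := 2)
    (Measure.measurePreserving_neg (volume : Measure V))).continuous
  refine (SchwartzMap.denseRange_toLpCLM (p := 2) ENNReal.ofNat_ne_top).induction_on
    (p := fun g : Lp (α := V) ℂ 2 => 𝓕 ((Complex.conjCLE : ℂ →L[ℝ] ℂ).compLp g) =
      (Complex.conjCLE : ℂ →L[ℝ] ℂ).compLp (Lp.compMeasurePreserving _
        (Measure.measurePreserving_neg (volume : Measure V)) (𝓕 g))) f ?_ ?_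
  · exact isClosed_eq (hfourier.comp hconj) (hconj.comp (hneg.comp hfourier))
  · exact fourier_compLp_conj_toLp

end Conjugation

theorem quasiMeasurePreserving_div_const {c : ℝ} (hc : c ≠ 0) :
    Measure.QuasiMeasurePreserving (fun x : ℝ => x / c) volume volume := by
  simp only [div_eq_inv_mul]
  exact Measure.quasiMeasurePreserving_smul volume (inv_ne_zero hc)

theorem memLp_two_comp_div {E : Type*} [NormedAddCommGroup E] {g : ℝ → E} (hg : MemLp g 2 volume)
    {c : ℝ} (hc : c ≠ 0) : MemLp (fun x => g (x / c)) 2 volume := by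
  have hm := hg.1.comp_quasiMeasurePreserving (quasiMeasurePreserving_div_const hc)
  rw [memLp_two_iff_integrable_sq_norm hg.1] at hg
  exact (memLp_two_iff_integrable_sq_norm hm).2 (hg.comp_div hc)

theorem memLp_hat (f : L2) : MemLp (hat f) 2 volume :=
  memLp_two_comp_div (Lp.memLp (𝓕 f)) (by positivity)

theorem integrable_norm_hat_sq (f : L2) : Integrable (fun ξ => ‖hat f ξ‖ ^ 2) :=
  (memLp_two_iff_integrable_sq_norm (memLp_hat f).1).1 (memLp_hat f)

theorem hat_neg {u : L2} (hu : ∀ᵐ x : ℝ, (u x).im = 0) :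
    ∀ᵐ ξ : ℝ, hat u (-ξ) = conj (hat u ξ) := by
  have hconj : (Complex.conjCLE : ℂ →L[ℝ] ℂ).compLp u = u := by
    ext1
    filter_upwards [(Complex.conjCLE : ℂ →L[ℝ] ℂ).coeFn_compLp u, hu] with x h₁ h₂
    rw [h₁]
    exact Complex.conj_eq_iff_im.2 h₂
  have hneg := Measure.measurePreserving_neg (volume : Measure ℝ)
  have hfourier : ∀ᵐ ζ : ℝ, (𝓕 u : L2) ζ = conj ((𝓕 u : L2) (-ζ)) := by
    nth_rw 1 [← hconj, fourier_compLp_conj]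
    filter_upwards [(Complex.conjCLE : ℂ →L[ℝ] ℂ).coeFn_compLp
        (Lp.compMeasurePreserving _ hneg (𝓕 u : L2)),
      Lp.coeFn_compMeasurePreserving (𝓕 u : L2) hneg] with ζ h₁ h₂
    rw [h₁, h₂]
    rfl
  filter_upwards [(quasiMeasurePreserving_div_const (c := 2 * Real.pi) (by positivity)).ae
    hfourier] with ξ hξ
  simp only [hat, hξ, neg_div, Complex.conj_conj]

theorem hat_ofHat {g : ℝ → ℂ} (hg : MemLp g 2 volume) : hat (ofHat g) =ᵐ[volume] g := by
  have h : MemLp (fun ζ : ℝ => g (2 * Real.pi * ζ)) 2 volume := by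
    simpa only [div_inv_eq_mul, mul_comm] using
      memLp_two_comp_div hg (c := (2 * Real.pi)⁻¹) (by positivity)
  filter_upwards [(quasiMeasurePreserving_div_const (c := 2 * Real.pi) (by positivity)).ae
    h.coeFn_toLp] with ξ hξ
  rw [hat, ofHat, dif_pos h, FourierTransform.fourier_fourierInv_eq, hξ,
    mul_div_cancel₀ ξ (by positivity)]

theorem inner_eq_integral_hat (f g : L2) :
    inner ℂ f g = ((2 * Real.pi)⁻¹ : ℝ) * ∫ ξ, conj (hat f ξ) * hat g ξ := by
  have h := Measure.integral_comp_div (fun ζ => conj (𝓕 f ζ) * 𝓕 g ζ) (2 * Real.pi)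
  rw [← Lp.inner_fourier_eq f g, L2.inner_def]
  simp only [hat, RCLike.inner_apply']
  rw [h, abs_of_pos (by positivity), Complex.real_smul, ← mul_assoc, ← Complex.ofReal_mul,
    inv_mul_cancel₀ (by positivity), Complex.ofReal_one, one_mul]

theorem norm_sq_eq_integral_hat (f : L2) :
    ‖f‖ ^ 2 = (2 * Real.pi)⁻¹ * ∫ ξ, ‖hat f ξ‖ ^ 2 := by
  have h := inner_eq_integral_hat f f
  simp_rw [Complex.conj_mul'] at h
  rw [inner_self_eq_norm_sq_to_K] at h
  norm_cast at h
  exact Complex.ofReal_injective h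

section Bessel

variable {V F : Type*} [NormedAddCommGroup V] [InnerProductSpace ℝ V] [FiniteDimensional ℝ V]
  [MeasurableSpace V] [BorelSpace V]

theorem smul_ae_eq_of_smulLeftCLM_eq [NormedAddCommGroup F] [NormedSpace ℂ F] [CompleteSpace F]
    {g h : V → ℂ} (hg : g.HasTemperateGrowth) (hh : h.HasTemperateGrowth) (hhg : h * g = 1)
    (hhm : MemLp h ⊤ volume) {w f : Lp (α := V) F 2}
    (hwf : TemperedDistribution.smulLeftCLM F g (w : 𝓢'(V, F)) = f) :
    (fun x => g x • w x) =ᵐ[volume] f := by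
  have toTemperedDistribution_injective := LinearMap.ker_eq_bot.1
    (Lp.ker_toTemperedDistributionCLM_eq_bot (F := F) (μ := (volume : Measure V)) (p := 2))
  have hw : w = (hhm.toLp h • f : Lp (α := V) F 2) := by
    apply toTemperedDistribution_injective
    change (w : 𝓢'(V, F)) = ((hhm.toLp h • f : Lp (α := V) F 2) : 𝓢'(V, F))
    rw [Lp.toTemperedDistribution_smul_eq hh hhm f, ← hwf,
      TemperedDistribution.smulLeftCLM_smulLeftCLM_apply hg hh, mul_comm, hhg]
    exact ((TemperedDistribution.smulLeftCLM_const 1 _).trans (one_smul _ _)).symm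
  rw [hw]
  filter_upwards [Lp.coeFn_lpSMul (r := 2) (hhm.toLp h) f, hhm.coeFn_toLp] with x h₁ h₂
  rw [h₁, Pi.smul_apply', h₂, smul_smul, mul_comm, ← Pi.mul_apply, hhg, Pi.one_apply, one_smul]

theorem memLp_bessel_smul_fourier [NormedAddCommGroup F] [InnerProductSpace ℂ F] [CompleteSpace F]
    {s : ℝ} (hs : 0 ≤ s) {u : Lp (α := V) F 2}
    (hu : TemperedDistribution.MemSobolev s 2 (u : 𝓢'(V, F))) :
    MemLp (fun ζ : V => (((1 + ‖ζ‖ ^ 2) ^ (s / 2) : ℝ) : ℂ) • (𝓕 u : Lp (α := V) F 2) ζ) 2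
      volume := by
  obtain ⟨f, hf⟩ := TemperedDistribution.memSobolev_iff_exists_smulLeftCLM_fourier.1 hu
  rw [Lp.fourier_toTemperedDistribution_eq] at hf
  set h : V → ℂ := fun ζ => (((1 + ‖ζ‖ ^ 2) ^ (-s / 2) : ℝ) : ℂ) with h_def
  have hh : h.HasTemperateGrowth := by rw [h_def]; fun_prop
  have h_norm_le (ζ : V) : ‖h ζ‖ ≤ 1 := by
    rw [h_def, Complex.norm_real, Real.norm_of_nonneg (by positivity)]
    exact Real.rpow_le_one_of_one_le_of_nonpos (by simp) (by linarith)
  have h_mul : (h * fun ζ : V => (((1 + ‖ζ‖ ^ 2) ^ (s / 2) : ℝ) : ℂ)) = 1 := by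
    ext ζ
    rw [Pi.mul_apply, h_def, ← Complex.ofReal_mul, ← Real.rpow_add (by positivity), neg_div,
      neg_add_cancel, Real.rpow_zero, Complex.ofReal_one, Pi.one_apply]
  exact (Lp.memLp f).ae_eq (smul_ae_eq_of_smulLeftCLM_eq (by fun_prop) hh h_mul
    (memLp_top_of_bound hh.1.continuous.aestronglyMeasurable 1 (Eventually.of_forall h_norm_le))
    hf).symm

end Bessel

theorem one_add_two_pi_mul_pow_le (N : ℕ) (ζ : ℝ) :
    (1 + |2 * Real.pi * ζ|) ^ N ≤ 10 ^ N * (1 + ‖ζ‖ ^ 2) ^ ((N : ℝ) / 2) := by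
  have hπ : 2 * Real.pi ≤ 6.3 := by linarith [Real.pi_lt_d2]
  rw [Real.rpow_div_two_eq_sqrt _ (by positivity), Real.rpow_natCast, ← mul_pow, abs_mul,
    abs_of_pos (by positivity : 0 < 2 * Real.pi)]
  gcongr
  refine (add_le_add_right (mul_le_mul_of_nonneg_right hπ (abs_nonneg ζ)) 1).trans ?_
  refine abs_le_of_sq_le_sq' ?_ (by positivity) |>.2
  rw [mul_pow, Real.sq_sqrt (by positivity), Real.norm_eq_abs]
  nlinarith [sq_nonneg (1 - |ζ|)]

theorem memLp_weight_hat {N : ℕ} {u : L2}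
    (hu : TemperedDistribution.MemSobolev (N : ℝ) 2 (u : 𝓢'(ℝ, ℂ))) :
    MemLp (fun ξ => ((1 + |ξ|) ^ N : ℝ) * hat u ξ) 2 volume := by
  have hm : MemLp (fun ζ => (((1 + |2 * Real.pi * ζ|) ^ N : ℝ) : ℂ) * (𝓕 u : L2) ζ) 2 volume := by
    refine (memLp_bessel_smul_fourier N.cast_nonneg hu).of_le_mul (c := 10 ^ N) ?_ ?_
    · exact (Continuous.aestronglyMeasurable (by fun_prop)).mul (Lp.aestronglyMeasurable _)
    · refine Eventually.of_forall fun ζ => ?_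
      rw [norm_mul, norm_smul, Complex.norm_real, Complex.norm_real,
        Real.norm_of_nonneg (by positivity), Real.norm_of_nonneg (by positivity), ← mul_assoc]
      exact mul_le_mul_of_nonneg_right (one_add_two_pi_mul_pow_le N ζ) (norm_nonneg _)
  refine (memLp_two_comp_div hm (c := 2 * Real.pi) (by positivity)).ae_eq
    (Eventually.of_forall fun ξ => ?_)
  simp only [hat, mul_div_cancel₀ ξ (by positivity : 2 * Real.pi ≠ 0)]

/-! ### The size of the resonance function -/

/-- The properties of the symbol `p` that the energy estimate rests on. The integer `j` measures
how flat `p` is at the origin: `gap` holds at low frequencies if `p - p 0` vanishes to order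
`2 * j`, and at high frequencies if `|p'|` decays no faster than `|ξ| ^ (-2)`. -/
structure IsDispersive (p : ℝ → ℝ) (j : ℕ) : Prop where
  continuous : Continuous p
  even : ∀ ξ, p (-ξ) = p ξ
  monotone : MonotoneOn p (Set.Ici 0) ∨ AntitoneOn p (Set.Ici 0)
  gap : ∃ κ > 0, ∀ a c, 0 ≤ a → 2 * a ≤ c → κ * min 1 c ^ (2 * j) / (1 + a) ≤ |p c - p a|

theorem abs_sub_le_of_monotoneOn_or_antitoneOn {p : ℝ → ℝ} {s : Set ℝ} [hs : s.OrdConnected]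
    (hp : MonotoneOn p s ∨ AntitoneOn p s) {a b c d : ℝ} (ha : a ∈ s) (hd : d ∈ s) (hab : a ≤ b)
    (hbc : b ≤ c) (hcd : c ≤ d) : |p c - p b| ≤ |p d - p a| := by
  have hb : b ∈ s := hs.out ha hd ⟨hab, hbc.trans hcd⟩
  have hc : c ∈ s := hs.out ha hd ⟨hab.trans hbc, hcd⟩
  rcases hp with h | h
  · rw [abs_of_nonneg (sub_nonneg.2 (h hb hc hbc))]
    exact (sub_le_sub (h hc hd hcd) (h ha hb hab)).trans (le_abs_self _)
  · rw [abs_sub_comm, abs_of_nonneg (sub_nonneg.2 (h hb hc hbc)), abs_sub_comm]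
    exact (sub_le_sub (h ha hb hab) (h hc hd hcd)).trans (le_abs_self _)

theorem exists_mul_pow_le_abs_sub_half {p q : ℝ → ℝ} {n : ℕ} (hn : n ≠ 0) (hq : ContinuousAt q 0)
    (hq₀ : q 0 ≠ 0) (hpq : ∀ᶠ ξ in 𝓝 0, p ξ = p 0 + ξ ^ n * q ξ) :
    ∃ κ > 0, ∀ᶠ c in 𝓝 0, κ * |c| ^ n ≤ |p c - p (c / 2)| := by
  have hhalf : Tendsto (fun c : ℝ => c / 2) (𝓝 0) (𝓝 0) := by
    simpa using (continuous_id.div_const (2 : ℝ)).tendsto 0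
  have hlim : Tendsto (fun c => |q c - (1 / 2) ^ n * q (c / 2)|) (𝓝 0)
      (𝓝 |q 0 - (1 / 2) ^ n * q 0|) :=
    (hq.tendsto.sub ((hq.tendsto.comp hhalf).const_mul _)).abs
  have hpos : 0 < |q 0 - (1 / 2) ^ n * q 0| := by
    rw [abs_pos, ← one_sub_mul]
    exact mul_ne_zero (sub_pos.2 (pow_lt_one₀ (by norm_num) (by norm_num) hn)).ne' hq₀
  refine ⟨_, half_pos hpos, ?_⟩
  filter_upwards [hlim.eventually_const_le (half_lt_self hpos), hpq, hhalf.eventually hpq]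
    with c hc hpc hpc'
  have hfactor : p c - p (c / 2) = (q c - (1 / 2) ^ n * q (c / 2)) * c ^ n := by
    rw [hpc, hpc', div_pow, div_pow]
    ring
  rw [hfactor, abs_mul, abs_pow]
  gcongr

theorem exists_div_pow_le_abs_sub_double {p : ℝ → ℝ} (hp : Differentiable ℝ p) {n : ℕ} {c : ℝ}
    (hc : 0 < c) (hderiv : ∀ᶠ ξ in atTop, c / ξ ^ (n + 1) ≤ |deriv p ξ|) :
    ∃ κ > 0, ∀ᶠ a in atTop, κ / a ^ n ≤ |p (2 * a) - p a| := by
  refine ⟨c / 2 ^ (n + 1), by positivity, ?_⟩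
  filter_upwards [eventually_forall_ge_atTop.2 hderiv, eventually_gt_atTop 0] with a ha ha₀
  obtain ⟨x, ⟨hax, hxa⟩, hx⟩ := exists_deriv_eq_slope p (by linarith : a < 2 * a)
    hp.continuous.continuousOn hp.differentiableOn
  have hslope : p (2 * a) - p a = deriv p x * a := by
    rw [hx]
    field_simp
    ring
  have hx₀ : 0 < x := ha₀.trans hax
  calc c / 2 ^ (n + 1) / a ^ n = c / (2 * a) ^ (n + 1) * a := by
        rw [mul_pow, pow_succ a]
        field_simp
    _ ≤ c / x ^ (n + 1) * a := by gcongr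
    _ ≤ |deriv p x| * a := by gcongr; exact ha x hax.le
    _ = |p (2 * a) - p a| := by rw [hslope, abs_mul, abs_of_pos ha₀]

section Gap

variable {p : ℝ → ℝ} (hmono : StrictMonoOn p (Set.Ici 0) ∨ StrictAntiOn p (Set.Ici 0))

include hmono

theorem exists_pos_le_abs_sub (hcont : Continuous p) {r : ℝ} (hr : 0 < r) (R : ℝ) :
    ∃ κ > 0, ∀ a c, 0 ≤ a → a ≤ R → r ≤ c → 2 * a ≤ c → κ ≤ |p c - p a| := by
  set M := max r (2 * R)
  have hpos : ∀ c ∈ Set.Icc r M, 0 < |p c - p (c / 2)| := by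
    rintro c ⟨hrc, -⟩
    have hc : c / 2 < c := by linarith
    have hc₀ : c / 2 ∈ Set.Ici 0 := Set.mem_Ici.2 (by linarith)
    rw [abs_pos, sub_ne_zero]
    exact hmono.elim (fun h => (h hc₀ (hr.le.trans hrc) hc).ne')
      fun h => (h hc₀ (hr.le.trans hrc) hc).ne
  obtain ⟨κ, hκ, hκ_le⟩ := isCompact_Icc.exists_forall_le' (by fun_prop) hpos
  refine ⟨κ, hκ, fun a c ha haR hrc hac => ?_⟩
  have hrM : r ≤ min c M := le_min hrc (le_max_left _ _)
  have haM : 2 * a ≤ min c M := le_min hac (by linarith [le_max_right r (2 * R)])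
  exact (hκ_le _ ⟨hrM, min_le_right _ _⟩).trans
    (abs_sub_le_of_monotoneOn_or_antitoneOn
      (hmono.imp StrictMonoOn.monotoneOn StrictAntiOn.antitoneOn) ha (hr.le.trans hrc)
      (by linarith) (by linarith) (min_le_left _ _))

theorem exists_gap_of_near_of_far (hcont : Continuous p) {n : ℕ}
    (hnear : ∃ κ > 0, ∀ᶠ c in 𝓝 0, κ * |c| ^ n ≤ |p c - p (c / 2)|)
    (hfar : ∃ κ > 0, ∀ᶠ a in atTop, κ / a ≤ |p (2 * a) - p a|) :
    ∃ κ > 0, ∀ a c, 0 ≤ a → 2 * a ≤ c → κ * min 1 c ^ n / (1 + a) ≤ |p c - p a| := by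
  have hmono' := hmono.imp StrictMonoOn.monotoneOn StrictAntiOn.antitoneOn
  obtain ⟨κ₁, hκ₁, hnear⟩ := hnear
  obtain ⟨r, hr, hnear⟩ := Metric.nhds_basis_closedBall.eventually_iff.1 hnear
  obtain ⟨κ₂, hκ₂, hfar⟩ := hfar
  obtain ⟨R, hR, hfar⟩ := (atTop_basis' (1 : ℝ)).eventually_iff.1 hfar
  obtain ⟨κ₃, hκ₃, hmid⟩ := exists_pos_le_abs_sub hmono hcont hr R
  set κ := min κ₁ (min κ₂ κ₃)
  have hκκ₁ : κ ≤ κ₁ := min_le_left _ _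
  have hκκ₂ : κ ≤ κ₂ := (min_le_right _ _).trans (min_le_left _ _)
  have hκκ₃ : κ ≤ κ₃ := (min_le_right _ _).trans (min_le_right _ _)
  have hκ : 0 < κ := by positivity
  refine ⟨κ, hκ, fun a c ha hac => ?_⟩
  have hc : 0 ≤ c := by linarith
  have hmin : 0 ≤ min 1 c := le_min zero_le_one hc
  have hdenom : κ * min 1 c ^ n / (1 + a) ≤ κ * min 1 c ^ n :=
    div_le_self (by positivity) (by linarith)
  have hnum : κ * min 1 c ^ n ≤ κ :=
    mul_le_of_le_one_right hκ.le (pow_le_one₀ hmin (min_le_left _ _))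
  rcases le_total c r with hcr | hrc
  · calc κ * min 1 c ^ n / (1 + a) ≤ κ * min 1 c ^ n := hdenom
      _ ≤ κ₁ * |c| ^ n := by gcongr; exact (min_le_right _ _).trans (le_abs_self _)
      _ ≤ |p c - p (c / 2)| :=
        hnear (by rwa [Metric.mem_closedBall, dist_zero_right, Real.norm_of_nonneg hc])
      _ ≤ |p c - p a| :=
        abs_sub_le_of_monotoneOn_or_antitoneOn hmono' ha hc (by linarith) (by linarith) le_rfl
  rcases le_total R a with hRa | haR
  · have ha₀ : 0 < a := by linarith
    calc κ * min 1 c ^ n / (1 + a) ≤ κ₂ / a := by gcongr <;> linarith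
      _ ≤ |p (2 * a) - p a| := hfar hRa
      _ ≤ |p c - p a| :=
        abs_sub_le_of_monotoneOn_or_antitoneOn hmono' ha hc le_rfl (by linarith) hac
  · exact (hdenom.trans (hnum.trans hκκ₃)).trans (hmid a c ha haR hrc hac)

end Gap

theorem IsSymbol.isDispersive {p : ℝ → ℝ} {α : ℝ} {j : ℕ} (hp : IsSymbol p α j) (hα : -1 ≤ α)
    (hj : 1 ≤ j) : IsDispersive p j where
  continuous := hp.contDiff.continuous
  even := hp.even
  monotone := hp.strictMonotone.imp StrictMonoOn.monotoneOn StrictAntiOn.antitoneOn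
  gap := by
    refine exists_gap_of_near_of_far hp.strictMonotone hp.contDiff.continuous ?_ ?_
    · obtain ⟨q, hq, hq₀, δ, hδ, hpq⟩ := hp.nearField
      refine exists_mul_pow_le_abs_sub_half (by omega) hq.continuous.continuousAt hq₀ ?_
      filter_upwards [Metric.ball_mem_nhds 0 hδ] with ξ hξ
      exact hpq ξ (by simpa using hξ)
    · obtain ⟨c, hc, C, -, R, -, hfar⟩ := hp.farField
      have hderiv : ∀ᶠ ξ in atTop, c / ξ ^ (1 + 1) ≤ |deriv p ξ| := by
        filter_upwards [eventually_ge_atTop R, eventually_ge_atTop 1] with ξ hR hξ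
        have hξ₀ : 0 < ξ := by linarith
        have hlower := (hfar ξ (hR.trans (le_abs_self ξ))).2.1.1
        rw [abs_of_pos hξ₀] at hlower
        calc c / ξ ^ (1 + 1) = c * ξ ^ (-2 : ℝ) := by
              rw [Real.rpow_neg hξ₀.le, Real.rpow_two, div_eq_mul_inv]
          _ ≤ c * ξ ^ (α - 1) := by gcongr; linarith
          _ ≤ |deriv p ξ| := hlower
      simpa using
        exists_div_pow_le_abs_sub_double (hp.contDiff.differentiable (by norm_num)) hc hderiv

theorem IsDispersive.one_le {p : ℝ → ℝ} {j : ℕ} (hp : IsDispersive p j) : 1 ≤ j := by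
  obtain ⟨κ, hκ, hgap⟩ := hp.gap
  by_contra! hj
  obtain rfl : j = 0 := by omega
  have h := hgap 0 0 le_rfl (by simp)
  simp only [mul_zero, pow_zero, mul_one, add_zero, div_one, sub_self, abs_zero] at h
  exact hκ.not_ge h

/-- The resonance function of the quadratic interaction: `mult p a b` is `(a + b) / 2` divided by
`phase p a b`. -/
def phase (p : ℝ → ℝ) (a b : ℝ) : ℝ := p a * a + p b * b - p (a + b) * (a + b)

theorem neg_add_add_cancel_right {G : Type*} [AddCommGroup G] (a b : G) :
    -(a + b) + b = -a := by
  abel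

theorem phase_swap (p : ℝ → ℝ) (a b : ℝ) : phase p b a = phase p a b := by
  rw [phase, phase, add_comm b a]
  ring

theorem phase_neg {p : ℝ → ℝ} (hp : ∀ ξ, p (-ξ) = p ξ) (a b : ℝ) :
    phase p (-a) (-b) = -phase p a b := by
  rw [phase, phase, ← neg_add, hp, hp, hp]
  ring

theorem phase_rot {p : ℝ → ℝ} (hp : ∀ ξ, p (-ξ) = p ξ) (a b : ℝ) :
    phase p (-(a + b)) b = phase p a b := by
  rw [phase, phase, neg_add_add_cancel_right, hp, hp]
  ring

theorem continuous_phase {p : ℝ → ℝ} (hp : Continuous p) :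
    Continuous fun z : ℝ × ℝ => phase p z.1 z.2 := by
  unfold phase
  fun_prop

theorem abs_phase_eq {p : ℝ → ℝ} (hp : MonotoneOn p (Set.Ici 0) ∨ AntitoneOn p (Set.Ici 0))
    {a b : ℝ} (ha : 0 ≤ a) (hb : 0 ≤ b) :
    |phase p a b| = a * |p (a + b) - p a| + b * |p (a + b) - p b| := by
  have hab : 0 ≤ a + b := add_nonneg ha hb
  have hdecomp : phase p a b = -(a * (p (a + b) - p a) + b * (p (a + b) - p b)) := by
    rw [phase]
    ring
  have hsign : 0 ≤ p (a + b) - p a ∧ 0 ≤ p (a + b) - p b ∨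
      p (a + b) - p a ≤ 0 ∧ p (a + b) - p b ≤ 0 := by
    simp only [sub_nonneg, sub_nonpos]
    exact hp.imp
      (fun h => ⟨h ha hab (le_add_of_nonneg_right hb), h hb hab (le_add_of_nonneg_left ha)⟩)
      fun h => ⟨h ha hab (le_add_of_nonneg_right hb), h hb hab (le_add_of_nonneg_left ha)⟩
  rw [hdecomp, abs_neg, abs_add_eq_add_abs_iff _ _ |>.2, abs_mul, abs_mul, abs_of_nonneg ha,
    abs_of_nonneg hb]
  exact hsign.imp (And.imp (mul_nonneg ha) (mul_nonneg hb))
    (And.imp (mul_nonpos_of_nonneg_of_nonpos ha) (mul_nonpos_of_nonneg_of_nonpos hb))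

theorem IsDispersive.exists_le_abs_phase {p : ℝ → ℝ} {j : ℕ} (hp : IsDispersive p j) :
    ∃ κ > 0, ∀ a b, 0 ≤ a → a ≤ b →
      κ * (a * min 1 (a + b) ^ (2 * j) / (1 + a)) ≤ |phase p a b| := by
  obtain ⟨κ, hκ, hgap⟩ := hp.gap
  refine ⟨κ, hκ, fun a b ha hab => ?_⟩
  have hb : 0 ≤ b := ha.trans hab
  calc κ * (a * min 1 (a + b) ^ (2 * j) / (1 + a))
      = a * (κ * min 1 (a + b) ^ (2 * j) / (1 + a)) := by ring
    _ ≤ a * |p (a + b) - p a| := by gcongr; exact hgap a (a + b) ha (by linarith)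
    _ ≤ |phase p a b| := by
      rw [abs_phase_eq hp.monotone ha hb]
      exact le_add_of_nonneg_right (by positivity)

theorem frequency_induction {P : ℝ → ℝ → Prop} (swap : ∀ a b, P a b → P b a)
    (neg : ∀ a b, P a b → P (-a) (-b)) (rot : ∀ a b, P a b → P (-(a + b)) b)
    (ordered : ∀ a b, 0 < a → a ≤ b → P a b) {a b : ℝ} (ha : a ≠ 0) (hb : b ≠ 0)
    (hab : a + b ≠ 0) : P a b := by
  have of_pos : ∀ a b, 0 < a → 0 < b → P a b := fun a b ha hb =>
    (le_total a b).elim (ordered a b ha) fun hba => swap _ _ (ordered b a hb hba)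
  have of_pos_left : ∀ a b, 0 < a → b ≠ 0 → a + b ≠ 0 → P a b := by
    intro a b ha hb hab
    rcases hb.gt_or_lt with hb | hb
    · exact of_pos a b ha hb
    rcases hab.gt_or_lt with hab | hab
    · simpa using rot _ _ (neg _ _ (of_pos (a + b) (-b) hab (by linarith)))
    · simpa using swap _ _ (rot _ _ (of_pos (-(a + b)) a (by linarith) ha))
  rcases ha.gt_or_lt with ha | ha
  · exact of_pos_left a b ha hb hab
  · simpa using neg _ _ (of_pos_left (-a) (-b) (by linarith) (neg_ne_zero.2 hb)
      (by rwa [← neg_add, neg_ne_zero]))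

theorem IsDispersive.exists_pos_le_abs_phase {p : ℝ → ℝ} {j : ℕ} (hp : IsDispersive p j) {ε : ℝ}
    (hε : 0 < ε) :
    ∃ δ > 0, ∀ a b, ε ≤ |a| → ε ≤ |b| → ε ≤ |a + b| → δ ≤ |phase p a b| := by
  obtain ⟨κ, hκ, hphase⟩ := hp.exists_le_abs_phase
  refine ⟨κ * (ε * min 1 ε ^ (2 * j) / (1 + ε)), by positivity, fun a b ha hb hab => ?_⟩
  refine frequency_induction
    (P := fun a b => ε ≤ |a| → ε ≤ |b| → ε ≤ |a + b| →
      κ * (ε * min 1 ε ^ (2 * j) / (1 + ε)) ≤ |phase p a b|)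
    (fun a b h hb ha hab => ?_) (fun a b h ha hb hab => ?_) (fun a b h hab hb ha => ?_)
    (fun a b ha hab hεa _ _ => ?_) (abs_pos.1 (hε.trans_le ha)) (abs_pos.1 (hε.trans_le hb))
    (abs_pos.1 (hε.trans_le hab)) ha hb hab
  · rw [phase_swap]
    exact h ha hb (by rwa [add_comm])
  · rw [phase_neg hp.even, abs_neg]
    rw [abs_neg] at ha hb
    rw [← neg_add, abs_neg] at hab
    exact h ha hb hab
  · rw [phase_rot hp.even]
    rw [abs_neg] at hab
    rw [neg_add_add_cancel_right, abs_neg] at ha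
    exact h ha hb hab
  rw [abs_of_pos ha] at hεa
  have hdiv : ε / (1 + ε) ≤ a / (1 + a) := by
    rw [div_le_div_iff₀ (by positivity) (by positivity)]
    linarith
  calc κ * (ε * min 1 ε ^ (2 * j) / (1 + ε)) = κ * (ε / (1 + ε) * min 1 ε ^ (2 * j)) := by ring
    _ ≤ κ * (a / (1 + a) * min 1 (a + b) ^ (2 * j)) := by gcongr; linarith
    _ = κ * (a * min 1 (a + b) ^ (2 * j) / (1 + a)) := by ring
    _ ≤ |phase p a b| := hphase a b ha.le hab

/-! ### The symmetrized multiplier -/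

theorem abs_pow_add_pow_sub_add_pow_le {a b : ℝ} (ha : 0 ≤ a) (hb : 0 ≤ b) {n : ℕ} (hn : n ≠ 0) :
    |a ^ n + b ^ n - (a + b) ^ n| ≤ n * (a * (a + b) ^ (n - 1)) := by
  calc |a ^ n + b ^ n - (a + b) ^ n| = (a + b) ^ n - (a ^ n + b ^ n) := by
        rw [abs_sub_comm, abs_of_nonneg (sub_nonneg.2 (pow_add_pow_le ha hb hn))]
    _ ≤ (a + b) ^ n - b ^ n := by gcongr; exact le_add_of_nonneg_left (by positivity)
    _ ≤ |(a + b) - b| * n * max |a + b| |b| ^ (n - 1) :=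
        (le_abs_self _).trans (abs_pow_sub_pow_le _ _ _)
    _ = n * (a * (a + b) ^ (n - 1)) := by
        rw [add_sub_cancel_right, abs_of_nonneg ha, abs_of_nonneg hb,
          abs_of_nonneg (add_nonneg ha hb), max_eq_left (le_add_of_nonneg_left ha)]
        ring

/-- The multiplier of the energy of order `k` after averaging over the three frequencies `a`, `b`
and `-(a + b)`, up to a constant factor. -/
def symMult (p : ℝ → ℝ) (k : ℕ) (a b : ℝ) : ℝ :=
  (a ^ (2 * k + 1) + b ^ (2 * k + 1) - (a + b) ^ (2 * k + 1)) / phase p a b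

theorem symMult_swap (p : ℝ → ℝ) (k : ℕ) (a b : ℝ) : symMult p k b a = symMult p k a b := by
  rw [symMult, symMult, phase_swap, add_comm b a, add_comm (b ^ _)]

theorem symMult_neg {p : ℝ → ℝ} (hp : ∀ ξ, p (-ξ) = p ξ) (k : ℕ) (a b : ℝ) :
    symMult p k (-a) (-b) = symMult p k a b := by
  have hodd : Odd (2 * k + 1) := odd_two_mul_add_one k
  rw [symMult, symMult, phase_neg hp, ← neg_add, hodd.neg_pow, hodd.neg_pow, hodd.neg_pow,
    ← neg_div_neg_eq]
  ring

theorem symMult_rot {p : ℝ → ℝ} (hp : ∀ ξ, p (-ξ) = p ξ) (k : ℕ) (a b : ℝ) :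
    symMult p k (-(a + b)) b = symMult p k a b := by
  have hodd : Odd (2 * k + 1) := odd_two_mul_add_one k
  rw [symMult, symMult, phase_rot hp, neg_add_add_cancel_right, hodd.neg_pow, hodd.neg_pow]
  ring

/-- A weight that dominates `symMult p k`: in each term one of the three frequencies carries one
derivative and the other two carry `k` derivatives each. -/
def triWeight (k : ℕ) (a b : ℝ) : ℝ :=
  (1 + |a|) * ((1 + |b|) ^ k * (1 + |a + b|) ^ k) +
  (1 + |b|) * ((1 + |a|) ^ k * (1 + |a + b|) ^ k) +
  (1 + |a + b|) * ((1 + |a|) ^ k * (1 + |b|) ^ k)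

theorem triWeight_swap (k : ℕ) (a b : ℝ) : triWeight k b a = triWeight k a b := by
  rw [triWeight, triWeight, add_comm b a]
  ring

theorem triWeight_neg (k : ℕ) (a b : ℝ) : triWeight k (-a) (-b) = triWeight k a b := by
  simp only [triWeight, ← neg_add, abs_neg]

theorem triWeight_rot (k : ℕ) (a b : ℝ) : triWeight k (-(a + b)) b = triWeight k a b := by
  rw [triWeight, triWeight, neg_add_add_cancel_right, abs_neg, abs_neg]
  ring

theorem pow_le_one_add_pow_mul_min_pow {c : ℝ} (hc : 0 ≤ c) {m n : ℕ} (hmn : m ≤ n) :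
    c ^ n ≤ (1 + c) ^ n * min 1 c ^ m := by
  rcases le_total 1 c with h | h
  · rw [min_eq_left h, one_pow, mul_one]
    gcongr
    linarith
  · rw [min_eq_right h]
    exact (pow_le_pow_of_le_one hc h hmn).trans
      (le_mul_of_one_le_left (by positivity) (one_le_pow₀ (by linarith)))

theorem IsDispersive.exists_abs_symMult_le_of_le {p : ℝ → ℝ} {j k : ℕ} (hp : IsDispersive p j)
    (hk : j ≤ k) :
    ∃ C > 0, ∀ a b, 0 < a → a ≤ b → |symMult p k a b| ≤ C * triWeight k a b := by
  obtain ⟨κ, hκ, hphase⟩ := hp.exists_le_abs_phase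
  refine ⟨(2 * k + 1) * 2 ^ k / κ, by positivity, fun a b ha hab => ?_⟩
  have hb : 0 < b := ha.trans_le hab
  obtain ⟨c, hc⟩ : ∃ c, c = a + b := ⟨_, rfl⟩
  have hc₀ : 0 < c := by linarith
  have hdefect : |a ^ (2 * k + 1) + b ^ (2 * k + 1) - c ^ (2 * k + 1)| ≤
      (2 * k + 1) * (a * c ^ (2 * k)) := by
    rw [hc]
    exact_mod_cast abs_pow_add_pow_sub_add_pow_le ha.le hb.le (Nat.succ_ne_zero (2 * k))
  have hphase : κ * (a * min 1 c ^ (2 * j) / (1 + a)) ≤ |phase p a b| := by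
    rw [hc]
    exact hphase a b ha.le hab
  calc |symMult p k a b|
      ≤ (2 * k + 1) * (a * c ^ (2 * k)) / (κ * (a * min 1 c ^ (2 * j) / (1 + a))) := by
        rw [symMult, abs_div, ← hc]
        gcongr
    _ ≤ (2 * k + 1) * (a * ((1 + c) ^ (2 * k) * min 1 c ^ (2 * j))) /
          (κ * (a * min 1 c ^ (2 * j) / (1 + a))) := by
        gcongr
        exact pow_le_one_add_pow_mul_min_pow hc₀.le (by omega)
    _ = (2 * k + 1) / κ * ((1 + a) * ((1 + c) ^ k * (1 + c) ^ k)) := by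
        rw [two_mul k, pow_add]
        field_simp
    _ ≤ (2 * k + 1) / κ * ((1 + a) * ((2 * (1 + b)) ^ k * (1 + c) ^ k)) := by
        gcongr
        linarith
    _ = (2 * k + 1) * 2 ^ k / κ * ((1 + a) * ((1 + b) ^ k * (1 + c) ^ k)) := by
        rw [mul_pow]
        ring
    _ ≤ (2 * k + 1) * 2 ^ k / κ * triWeight k a b := by
        gcongr
        rw [triWeight, ← hc, abs_of_pos ha, abs_of_pos hb, abs_of_pos hc₀, add_assoc]
        exact le_add_of_nonneg_right (by positivity)

theorem IsDispersive.exists_abs_symMult_le {p : ℝ → ℝ} {j k : ℕ} (hp : IsDispersive p j)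
    (hk : j ≤ k) :
    ∃ C > 0, ∀ a b, a ≠ 0 → b ≠ 0 → a + b ≠ 0 → |symMult p k a b| ≤ C * triWeight k a b := by
  obtain ⟨C, hC, hle⟩ := hp.exists_abs_symMult_le_of_le hk
  refine ⟨C, hC, fun a b ha hb hab => frequency_induction
    (P := fun a b => |symMult p k a b| ≤ C * triWeight k a b) ?_ ?_ ?_ hle ha hb hab⟩
  · intro a b h
    rwa [symMult_swap, triWeight_swap]
  · intro a b h
    rwa [symMult_neg hp.even, triWeight_neg]
  · intro a b h
    rwa [symMult_rot hp.even, triWeight_rot]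

/-! ### Truncation -/

/-- The pairs of frequencies that `truncMult p ε` retains. -/
def truncSet (ε : ℝ) : Set (ℝ × ℝ) :=
  {z | (ε < |z.1| ∧ |z.1| < 1 / ε) ∧ (ε < |z.2| ∧ |z.2| < 1 / ε) ∧
    (ε < |z.1 + z.2| ∧ |z.1 + z.2| < 1 / ε)}

theorem mem_truncSet_swap {ε a b : ℝ} : (b, a) ∈ truncSet ε ↔ (a, b) ∈ truncSet ε := by
  simp only [truncSet, Set.mem_ofPred_eq, add_comm b a]
  tauto

theorem mem_truncSet_rot {ε a b : ℝ} : (-(a + b), b) ∈ truncSet ε ↔ (a, b) ∈ truncSet ε := by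
  simp only [truncSet, Set.mem_ofPred_eq, neg_add_add_cancel_right, abs_neg]
  tauto

theorem measurableSet_truncSet (ε : ℝ) : MeasurableSet (truncSet ε) := by
  have hband (f : ℝ × ℝ → ℝ) (hf : Continuous f) : MeasurableSet {z | ε < |f z| ∧ |f z| < 1 / ε} :=
    (measurableSet_lt measurable_const hf.abs.measurable).inter
      (measurableSet_lt hf.abs.measurable measurable_const)
  exact (hband _ continuous_fst).inter ((hband _ continuous_snd).inter (hband _ continuous_add))

theorem eventually_mem_truncSet {a b : ℝ} (ha : a ≠ 0) (hb : b ≠ 0) (hab : a + b ≠ 0) :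
    ∀ᶠ ε in 𝓝[>] (0 : ℝ), (a, b) ∈ truncSet ε := by
  have hband (x : ℝ) (hx : x ≠ 0) : ∀ᶠ ε in 𝓝[>] (0 : ℝ), ε < |x| ∧ |x| < 1 / ε := by
    simp only [one_div]
    exact (eventually_nhdsWithin_of_eventually_nhds (eventually_lt_nhds (abs_pos.2 hx))).and
      (tendsto_inv_nhdsGT_zero.eventually_gt_atTop |x|)
  exact (hband a ha).and ((hband b hb).and (hband (a + b) hab))

/-- The inverse of the resonance function, cut off to the frequencies in `truncSet ε`. -/
def invPhase (p : ℝ → ℝ) (ε a b : ℝ) : ℝ :=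
  (truncSet ε).indicator (fun z => (phase p z.1 z.2)⁻¹) (a, b)

theorem invPhase_swap (p : ℝ → ℝ) (ε a b : ℝ) : invPhase p ε b a = invPhase p ε a b := by
  classical
  simp only [invPhase, Set.indicator_apply, mem_truncSet_swap, phase_swap]

theorem invPhase_rot {p : ℝ → ℝ} (hp : ∀ ξ, p (-ξ) = p ξ) (ε a b : ℝ) :
    invPhase p ε (-(a + b)) b = invPhase p ε a b := by
  classical
  simp only [invPhase, Set.indicator_apply, mem_truncSet_rot, phase_rot hp]

theorem measurable_invPhase {p : ℝ → ℝ} (hp : Continuous p) (ε : ℝ) :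
    Measurable fun z : ℝ × ℝ => invPhase p ε z.1 z.2 :=
  (continuous_phase hp).measurable.inv.indicator (measurableSet_truncSet ε)

theorem IsDispersive.exists_abs_invPhase_le {p : ℝ → ℝ} {j : ℕ} (hp : IsDispersive p j) {ε : ℝ}
    (hε : 0 < ε) : ∃ C, ∀ a b, |invPhase p ε a b| ≤ C := by
  obtain ⟨δ, hδ, hphase⟩ := hp.exists_pos_le_abs_phase hε
  refine ⟨δ⁻¹, fun a b => ?_⟩
  by_cases hab : (a, b) ∈ truncSet ε
  · rw [invPhase, Set.indicator_of_mem hab, abs_inv]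
    gcongr
    exact hphase a b hab.1.1.le hab.2.1.1.le hab.2.2.1.le
  · rw [invPhase, Set.indicator_of_notMem hab, abs_zero]
    positivity

theorem truncMult_eq_indicator (p : ℝ → ℝ) (ε a b : ℝ) :
    truncMult p ε a b = (truncSet ε).indicator (fun z => mult p z.1 z.2) (a, b) := by
  classical
  exact ite_congr rfl (fun _ => rfl) fun _ => rfl

theorem truncMult_eq_mul_invPhase (p : ℝ → ℝ) (ε a b : ℝ) :
    truncMult p ε a b = (a + b) / 2 * invPhase p ε a b := by
  by_cases hab : (a, b) ∈ truncSet ε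
  · rw [truncMult_eq_indicator, invPhase, Set.indicator_of_mem hab, Set.indicator_of_mem hab,
      ← div_eq_mul_inv, div_div]
    rfl
  · rw [truncMult_eq_indicator, invPhase, Set.indicator_of_notMem hab,
      Set.indicator_of_notMem hab, mul_zero]

/-! ### Trilinear integrals -/

theorem abs_mul_mul_le {a : ℝ} (ha : 0 ≤ a) (b c : ℝ) :
    |a * (b * c)| ≤ (a * b ^ 2 + a * c ^ 2) / 2 := by
  rw [abs_mul, abs_of_nonneg ha, abs_mul]
  calc a * (|b| * |c|) ≤ a * ((|b| ^ 2 + |c| ^ 2) / 2) := by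
        gcongr
        linarith [two_mul_le_add_sq |b| |c|]
    _ = (a * b ^ 2 + a * c ^ 2) / 2 := by
        rw [sq_abs, sq_abs]
        ring

section Trilinear

variable {X Y : Type*} [MeasurableSpace X] [MeasurableSpace Y] {ρ : Measure X} {μ : Measure Y}
  {φ ψ χ : X → Y} {f g : Y → ℝ}

theorem integrable_mul_comp (hφψ : MeasurePreserving (fun x => (φ x, ψ x)) ρ (μ.prod μ))
    (hf : Integrable f μ) (hg : Integrable g μ) : Integrable (fun x => f (φ x) * g (ψ x)) ρ :=
  hφψ.integrable_comp_of_integrable (hf.mul_prod hg)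

theorem aestronglyMeasurable_comp_fst {E : Type*} [TopologicalSpace E] {f : Y → E}
    (hφψ : MeasurePreserving (fun x => (φ x, ψ x)) ρ (μ.prod μ)) (hf : AEStronglyMeasurable f μ) :
    AEStronglyMeasurable (fun x => f (φ x)) ρ :=
  hf.comp_fst.comp_quasiMeasurePreserving hφψ.quasiMeasurePreserving

theorem aestronglyMeasurable_comp_snd {E : Type*} [TopologicalSpace E] {f : Y → E}
    (hφψ : MeasurePreserving (fun x => (φ x, ψ x)) ρ (μ.prod μ)) (hf : AEStronglyMeasurable f μ) :
    AEStronglyMeasurable (fun x => f (ψ x)) ρ :=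
  hf.comp_snd.comp_quasiMeasurePreserving hφψ.quasiMeasurePreserving

theorem integrable_mul_mul_comp (hφψ : MeasurePreserving (fun x => (φ x, ψ x)) ρ (μ.prod μ))
    (hφχ : MeasurePreserving (fun x => (φ x, χ x)) ρ (μ.prod μ)) (hf : Integrable f μ)
    (hf₀ : 0 ≤ f) (hg : MemLp g 2 μ) : Integrable (fun x => f (φ x) * (g (ψ x) * g (χ x))) ρ :=
  (((integrable_mul_comp hφψ hf hg.integrable_sq).add
    (integrable_mul_comp hφχ hf hg.integrable_sq)).div_const 2).mono'
    ((aestronglyMeasurable_comp_fst hφψ hf.1).mul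
      ((aestronglyMeasurable_comp_snd hφψ hg.1).mul (aestronglyMeasurable_comp_snd hφχ hg.1)))
    (ae_of_all _ fun x => abs_mul_mul_le (hf₀ (φ x)) (g (ψ x)) (g (χ x)))

variable [SFinite μ]

theorem integral_mul_comp (hφψ : MeasurePreserving (fun x => (φ x, ψ x)) ρ (μ.prod μ))
    (hf : Integrable f μ) (hg : Integrable g μ) :
    ∫ x, f (φ x) * g (ψ x) ∂ρ = (∫ y, f y ∂μ) * ∫ y, g y ∂μ := by
  rw [← integral_prod_mul, ← hφψ.map_eq, integral_map hφψ.aemeasurable]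
  rw [hφψ.map_eq]
  exact (hf.mul_prod hg).aestronglyMeasurable

theorem integral_mul_mul_comp_le (hφψ : MeasurePreserving (fun x => (φ x, ψ x)) ρ (μ.prod μ))
    (hφχ : MeasurePreserving (fun x => (φ x, χ x)) ρ (μ.prod μ)) (hf : Integrable f μ)
    (hf₀ : 0 ≤ f) (hg : MemLp g 2 μ) :
    ∫ x, f (φ x) * (g (ψ x) * g (χ x)) ∂ρ ≤ (∫ y, f y ∂μ) * ∫ y, g y ^ 2 ∂μ := by
  have hψ := integrable_mul_comp hφψ hf hg.integrable_sq
  have hχ := integrable_mul_comp hφχ hf hg.integrable_sq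
  calc ∫ x, f (φ x) * (g (ψ x) * g (χ x)) ∂ρ
      ≤ ∫ x, (f (φ x) * g (ψ x) ^ 2 + f (φ x) * g (χ x) ^ 2) / 2 ∂ρ :=
        integral_mono (integrable_mul_mul_comp hφψ hφχ hf hf₀ hg) ((hψ.add hχ).div_const 2)
          fun x => (le_abs_self _).trans (abs_mul_mul_le (hf₀ (φ x)) (g (ψ x)) (g (χ x)))
    _ = (∫ y, f y ∂μ) * ∫ y, g y ^ 2 ∂μ := by
        rw [integral_div, integral_add hψ hχ, integral_mul_comp hφψ hf hg.integrable_sq,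
          integral_mul_comp hφχ hf hg.integrable_sq, add_self_div_two]

end Trilinear

theorem measurePreserving_fst_sub :
    MeasurePreserving (fun z : ℝ × ℝ => (z.1, z.1 - z.2)) volume (volume.prod volume) :=
  (MeasurePreserving.id (volume : Measure ℝ)).skew_product (g := fun x y => x - y)
    (measurable_fst.sub measurable_snd)
    (ae_of_all _ fun x => (Measure.measurePreserving_sub_left volume x).map_eq)

theorem measurePreserving_sub_snd :
    MeasurePreserving (fun z : ℝ × ℝ => (z.1 - z.2, z.2)) volume (volume.prod volume) :=
  measurePreserving_sub_prod volume volume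

theorem measurePreserving_sub_fst :
    MeasurePreserving (fun z : ℝ × ℝ => (z.1 - z.2, z.1)) volume (volume.prod volume) :=
  Measure.measurePreserving_swap.comp measurePreserving_fst_sub

theorem measurePreserving_snd_sub :
    MeasurePreserving (fun z : ℝ × ℝ => (z.2, z.1 - z.2)) volume (volume.prod volume) :=
  Measure.measurePreserving_swap.comp measurePreserving_sub_snd

theorem measurePreserving_snd_fst :
    MeasurePreserving (fun z : ℝ × ℝ => (z.2, z.1)) volume (volume.prod volume) :=
  Measure.measurePreserving_swap

theorem measurePreserving_fst_snd :
    MeasurePreserving (fun z : ℝ × ℝ => (z.1, z.2)) volume (volume.prod volume) :=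
  MeasurePreserving.id _

/-- The integrand `v(ξ - η) v(η) conj v(ξ)` of the cubic form, at `z = (ξ, η)`. -/
def cubic (v : ℝ → ℂ) (z : ℝ × ℝ) : ℂ := v (z.1 - z.2) * v z.2 * conj (v z.1)

theorem norm_cubic (v : ℝ → ℂ) (z : ℝ × ℝ) :
    ‖cubic v z‖ = ‖v (z.1 - z.2)‖ * (‖v z.2‖ * ‖v z.1‖) := by
  rw [cubic, norm_mul, norm_mul, RCLike.norm_conj, mul_assoc]

theorem aestronglyMeasurable_cubic {v : ℝ → ℂ} (hv : AEStronglyMeasurable v) :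
    AEStronglyMeasurable (cubic v) :=
  ((aestronglyMeasurable_comp_fst measurePreserving_sub_snd hv).mul hv.comp_snd).mul
    (Complex.continuous_conj.comp_aestronglyMeasurable hv.comp_fst)

theorem integrable_cubic {v : ℝ → ℂ} (hv : Integrable v) (hv₂ : MemLp v 2) :
    Integrable (cubic v) := by
  refine (integrable_mul_mul_comp measurePreserving_sub_snd measurePreserving_sub_fst hv.norm
    (fun x => norm_nonneg _) hv₂.norm).mono' (aestronglyMeasurable_cubic hv.1)
    (ae_of_all _ fun z => ?_)
  rw [norm_cubic]

section WeightedCubic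

variable {v : ℝ → ℂ} {k : ℕ} (hv₁ : Integrable fun x => (1 + |x|) * ‖v x‖)
  (hv₂ : MemLp (fun x => (1 + |x|) ^ k * ‖v x‖) 2)

theorem triWeight_mul_norm_cubic (v : ℝ → ℂ) (k : ℕ) (z : ℝ × ℝ) :
    triWeight k (z.1 - z.2) z.2 * ‖cubic v z‖ =
      (1 + |z.1 - z.2|) * ‖v (z.1 - z.2)‖ *
        ((1 + |z.2|) ^ k * ‖v z.2‖ * ((1 + |z.1|) ^ k * ‖v z.1‖)) +
      (1 + |z.2|) * ‖v z.2‖ *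
        ((1 + |z.1 - z.2|) ^ k * ‖v (z.1 - z.2)‖ * ((1 + |z.1|) ^ k * ‖v z.1‖)) +
      (1 + |z.1|) * ‖v z.1‖ *
        ((1 + |z.1 - z.2|) ^ k * ‖v (z.1 - z.2)‖ * ((1 + |z.2|) ^ k * ‖v z.2‖)) := by
  rw [norm_cubic, triWeight, sub_add_cancel]
  ring

include hv₁ hv₂

theorem integrable_triWeight_mul_norm_cubic :
    Integrable fun z : ℝ × ℝ => triWeight k (z.1 - z.2) z.2 * ‖cubic v z‖ := by
  have nonneg : 0 ≤ fun x => (1 + |x|) * ‖v x‖ := fun x => by positivity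
  have hint_sub := integrable_mul_mul_comp measurePreserving_sub_snd measurePreserving_sub_fst
    hv₁ nonneg hv₂
  have hint_snd := integrable_mul_mul_comp measurePreserving_snd_sub measurePreserving_snd_fst
    hv₁ nonneg hv₂
  have hint_fst := integrable_mul_mul_comp measurePreserving_fst_sub measurePreserving_fst_snd
    hv₁ nonneg hv₂
  simp only [triWeight_mul_norm_cubic]
  exact (hint_sub.fun_add hint_snd).add hint_fst

theorem integral_triWeight_mul_norm_cubic_le :
    ∫ z : ℝ × ℝ, triWeight k (z.1 - z.2) z.2 * ‖cubic v z‖ ≤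
      3 * ((∫ x, (1 + |x|) * ‖v x‖) * ∫ x, ((1 + |x|) ^ k * ‖v x‖) ^ 2) := by
  have nonneg : 0 ≤ fun x => (1 + |x|) * ‖v x‖ := fun x => by positivity
  have hint_sub := integrable_mul_mul_comp measurePreserving_sub_snd measurePreserving_sub_fst
    hv₁ nonneg hv₂
  have hint_snd := integrable_mul_mul_comp measurePreserving_snd_sub measurePreserving_snd_fst
    hv₁ nonneg hv₂
  have hint_fst := integrable_mul_mul_comp measurePreserving_fst_sub measurePreserving_fst_snd
    hv₁ nonneg hv₂
  have hle_sub := integral_mul_mul_comp_le measurePreserving_sub_snd measurePreserving_sub_fst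
    hv₁ nonneg hv₂
  have hle_snd := integral_mul_mul_comp_le measurePreserving_snd_sub measurePreserving_snd_fst
    hv₁ nonneg hv₂
  have hle_fst := integral_mul_mul_comp_le measurePreserving_fst_sub measurePreserving_fst_snd
    hv₁ nonneg hv₂
  simp only [triWeight_mul_norm_cubic]
  rw [integral_add (hint_sub.fun_add hint_snd) hint_fst, integral_add hint_sub hint_snd]
  linarith

end WeightedCubic

/-! ### Symmetrization of the cubic form -/

theorem cubic_sub_right (v : ℝ → ℂ) (z : ℝ × ℝ) : cubic v (z.1, z.1 - z.2) = cubic v z := by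
  rw [cubic, cubic, sub_sub_cancel, mul_comm (v z.2)]

theorem cubic_neg_swap {v : ℝ → ℂ} (hv : ∀ᵐ ξ, v (-ξ) = conj (v ξ)) :
    ∀ᵐ z : ℝ × ℝ, cubic v (-z.2, -z.1) = cubic v z := by
  filter_upwards [Measure.quasiMeasurePreserving_fst.ae hv,
    Measure.quasiMeasurePreserving_snd.ae hv] with z h_fst h_snd
  simp only [cubic, h_fst, h_snd, Complex.conj_conj, neg_sub_neg]
  ring

/-- The involution `(ξ, η) ↦ (ξ, ξ - η)` of the plane, which exchanges the frequencies `ξ - η` and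
`η`. -/
def subRightEquiv : ℝ × ℝ ≃ᵐ ℝ × ℝ :=
  MeasurableEquiv.ofInvolutive (fun z => (z.1, z.1 - z.2)) (fun z => by simp) (by fun_prop)

theorem measurePreserving_subRightEquiv : MeasurePreserving subRightEquiv volume volume :=
  measurePreserving_fst_sub

/-- The involution `(ξ, η) ↦ (-η, -ξ)` of the plane, which exchanges the frequencies `-ξ` and
`η`. -/
def negSwapEquiv : ℝ × ℝ ≃ᵐ ℝ × ℝ :=
  MeasurableEquiv.ofInvolutive (fun z => (-z.2, -z.1)) (fun z => by simp) (by fun_prop)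

theorem measurePreserving_negSwapEquiv : MeasurePreserving negSwapEquiv volume volume :=
  ((Measure.measurePreserving_neg (volume : Measure ℝ)).prod
    (Measure.measurePreserving_neg (volume : Measure ℝ))).comp Measure.measurePreserving_swap

/-- The integrand `R(ξ - η, η) v(ξ - η) v(η) conj v(ξ)` of the cubic form with kernel `R`, at
`z = (ξ, η)`. -/
def kernelCubic (R : ℝ → ℝ → ℝ) (v : ℝ → ℂ) (z : ℝ × ℝ) : ℂ :=
  (R (z.1 - z.2) z.2 : ℂ) * cubic v z

theorem kernelCubic_comp_subRightEquiv (R : ℝ → ℝ → ℝ) (v : ℝ → ℂ) :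
    kernelCubic R v ∘ subRightEquiv = kernelCubic (fun a b => R b a) v := by
  ext z
  change (R (z.1 - (z.1 - z.2)) (z.1 - z.2) : ℂ) * cubic v (z.1, z.1 - z.2) = _
  rw [cubic_sub_right, sub_sub_cancel]
  rfl

theorem kernelCubic_comp_negSwapEquiv (R : ℝ → ℝ → ℝ) {v : ℝ → ℂ}
    (hv : ∀ᵐ ξ, v (-ξ) = conj (v ξ)) :
    kernelCubic R v ∘ negSwapEquiv =ᵐ[volume] kernelCubic (fun a b => R a (-(a + b))) v := by
  filter_upwards [cubic_neg_swap hv] with z hz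
  change (R (-z.2 - -z.1) (-z.1) : ℂ) * cubic v (-z.2, -z.1) = _
  rw [hz, kernelCubic, neg_sub_neg, sub_add_cancel]

theorem integral_kernelCubic_swap (R : ℝ → ℝ → ℝ) (v : ℝ → ℂ) :
    ∫ z, kernelCubic (fun a b => R b a) v z = ∫ z, kernelCubic R v z := by
  rw [← kernelCubic_comp_subRightEquiv]
  exact measurePreserving_subRightEquiv.integral_comp' _

theorem integrable_kernelCubic_swap {R : ℝ → ℝ → ℝ} {v : ℝ → ℂ} :
    Integrable (kernelCubic (fun a b => R b a) v) ↔ Integrable (kernelCubic R v) := by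
  rw [← kernelCubic_comp_subRightEquiv]
  exact measurePreserving_subRightEquiv.integrable_comp_emb subRightEquiv.measurableEmbedding

theorem integral_kernelCubic_rot (R : ℝ → ℝ → ℝ) {v : ℝ → ℂ} (hv : ∀ᵐ ξ, v (-ξ) = conj (v ξ)) :
    ∫ z, kernelCubic (fun a b => R a (-(a + b))) v z = ∫ z, kernelCubic R v z := by
  rw [← integral_congr_ae (kernelCubic_comp_negSwapEquiv R hv)]
  exact measurePreserving_negSwapEquiv.integral_comp' _

theorem integrable_kernelCubic_rot {R : ℝ → ℝ → ℝ} {v : ℝ → ℂ}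
    (hv : ∀ᵐ ξ, v (-ξ) = conj (v ξ)) :
    Integrable (kernelCubic (fun a b => R a (-(a + b))) v) ↔ Integrable (kernelCubic R v) := by
  rw [← integrable_congr (kernelCubic_comp_negSwapEquiv R hv)]
  exact measurePreserving_negSwapEquiv.integrable_comp_emb negSwapEquiv.measurableEmbedding

theorem integral_kernelCubic_add_pow_mul {R : ℝ → ℝ → ℝ} (swap : ∀ a b, R b a = R a b)
    (rot : ∀ a b, R (-(a + b)) b = R a b) {v : ℝ → ℂ} (hv : ∀ᵐ ξ, v (-ξ) = conj (v ξ)) {n : ℕ}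
    (hn : Odd n) (hint : Integrable (kernelCubic (fun a b => (a + b) ^ n * R a b) v)) :
    ∫ z, kernelCubic (fun a b => (a + b) ^ n * R a b) v z =
      -(1 / 3) * ∫ z, kernelCubic (fun a b => (a ^ n + b ^ n - (a + b) ^ n) * R a b) v z := by
  have hrot (a b : ℝ) : (a + -(a + b)) ^ n * R a (-(a + b)) = -(b ^ n * R a b) := by
    rw [swap, add_comm a b, rot, swap, neg_add_rev, add_neg_cancel_left, hn.neg_pow, neg_mul]
  have kernelCubic_neg : kernelCubic (fun a b => -(b ^ n * R a b)) v =
      -kernelCubic (fun a b => b ^ n * R a b) v := by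
    ext z
    simp only [kernelCubic, Complex.ofReal_neg, neg_mul, Pi.neg_apply]
  have hint_right : Integrable (kernelCubic (fun a b => b ^ n * R a b) v) := by
    have h := (integrable_kernelCubic_rot hv).2 hint
    simpa only [hrot, kernelCubic_neg, integrable_neg_iff] using h
  have hint_left : Integrable (kernelCubic (fun a b => a ^ n * R a b) v) := by
    simpa only [swap] using integrable_kernelCubic_swap.2 hint_right
  have integral_right : ∫ z, kernelCubic (fun a b => b ^ n * R a b) v z =
      -∫ z, kernelCubic (fun a b => (a + b) ^ n * R a b) v z := by
    rw [← integral_kernelCubic_rot (fun a b => (a + b) ^ n * R a b) hv]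
    simp only [hrot, kernelCubic_neg, Pi.neg_apply, integral_neg, neg_neg]
  have integral_left : ∫ z, kernelCubic (fun a b => a ^ n * R a b) v z =
      ∫ z, kernelCubic (fun a b => b ^ n * R a b) v z := by
    simpa only [swap] using integral_kernelCubic_swap (fun a b => b ^ n * R a b) v
  have hsum (z : ℝ × ℝ) : kernelCubic (fun a b => (a ^ n + b ^ n - (a + b) ^ n) * R a b) v z =
      kernelCubic (fun a b => a ^ n * R a b) v z + kernelCubic (fun a b => b ^ n * R a b) v z -
        kernelCubic (fun a b => (a + b) ^ n * R a b) v z := by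
    simp only [kernelCubic]
    push_cast
    ring
  simp only [hsum]
  rw [integral_sub (hint_left.fun_add hint_right) hint, integral_add hint_left hint_right,
    integral_left, integral_right]
  ring

/-! ### Band-limited multipliers -/

/-- A bounded multiplier whose output frequency `a + b` is bounded: the class of multipliers, closed
under multiplication by powers of `a + b`, for which the pseudo-product preserves `L²`. -/
structure IsBandLimited (R : ℝ → ℝ → ℝ) : Prop where
  measurable : Measurable fun z : ℝ × ℝ => R z.1 z.2
  bounded : ∃ C, ∀ a b, |R a b| ≤ C
  band : ∃ M, ∀ a b, M < |a + b| → R a b = 0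

namespace IsBandLimited

variable {R : ℝ → ℝ → ℝ} (hR : IsBandLimited R)

include hR

theorem const_mul (c : ℝ) : IsBandLimited fun a b => c * R a b where
  measurable := hR.measurable.const_mul c
  bounded := by
    obtain ⟨C, hC⟩ := hR.bounded
    refine ⟨|c| * C, fun a b => ?_⟩
    rw [abs_mul]
    gcongr
    exact hC a b
  band := by
    obtain ⟨M, hM⟩ := hR.band
    exact ⟨M, fun a b h => by rw [hM a b h, mul_zero]⟩

theorem add_pow_mul (n : ℕ) : IsBandLimited fun a b => (a + b) ^ n * R a b where
  measurable := ((measurable_fst.add measurable_snd).pow_const n).mul hR.measurable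
  bounded := by
    obtain ⟨C, hC⟩ := hR.bounded
    obtain ⟨M, hM⟩ := hR.band
    have hC₀ : 0 ≤ C := (abs_nonneg _).trans (hC 0 0)
    refine ⟨|M| ^ n * C, fun a b => ?_⟩
    rcases lt_or_ge M |a + b| with h | h
    · rw [hM a b h, mul_zero, abs_zero]
      positivity
    · rw [abs_mul, abs_pow]
      exact mul_le_mul (pow_le_pow_left₀ (abs_nonneg _) (h.trans (le_abs_self M)) n) (hC a b)
        (abs_nonneg _) (by positivity)
  band := by
    obtain ⟨M, hM⟩ := hR.band
    exact ⟨M, fun a b h => by rw [hM a b h, mul_zero]⟩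

theorem measurable_sub_snd : Measurable fun z : ℝ × ℝ => (R (z.1 - z.2) z.2 : ℂ) :=
  Complex.measurable_ofReal.comp
    (hR.measurable.comp ((measurable_fst.sub measurable_snd).prodMk measurable_snd))

theorem integrable_kernelCubic {v : ℝ → ℂ} (hv : Integrable v) (hv₂ : MemLp v 2) :
    Integrable (kernelCubic R v) := by
  obtain ⟨C, hC⟩ := hR.bounded
  refine (integrable_cubic hv hv₂).bdd_mul (c := C) hR.measurable_sub_snd.aestronglyMeasurable
    (ae_of_all _ fun z => ?_)
  rw [Complex.norm_real]
  exact hC _ _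

theorem aestronglyMeasurable_pseudoHat (f g : L2) : AEStronglyMeasurable (pseudoHat R f g) :=
  AEStronglyMeasurable.integral_prod_right' (μ := volume) (ν := volume)
    (f := fun z : ℝ × ℝ => (R (z.1 - z.2) z.2 : ℂ) * hat f (z.1 - z.2) * hat g z.2)
    ((hR.measurable_sub_snd.aestronglyMeasurable.mul
      (aestronglyMeasurable_comp_fst measurePreserving_sub_snd (memLp_hat f).1)).mul
        (memLp_hat g).1.comp_snd)

theorem exists_norm_pseudoHat_le (f g : L2) : ∃ C, ∀ ξ, ‖pseudoHat R f g ξ‖ ≤ C := by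
  obtain ⟨C, hC⟩ := hR.bounded
  refine ⟨C * ((∫ η, ‖hat f η‖ ^ 2) + ∫ η, ‖hat g η‖ ^ 2), fun ξ => ?_⟩
  have hf := (integrable_norm_hat_sq f).comp_sub_left ξ
  have hg := integrable_norm_hat_sq g
  rw [← integral_sub_left_eq_self (fun η => ‖hat f η‖ ^ 2) _ ξ, ← integral_add hf hg,
    ← integral_const_mul]
  refine norm_integral_le_of_norm_le ((hf.add hg).const_mul C) (ae_of_all _ fun η => ?_)
  rw [mul_assoc, norm_mul, norm_mul, Complex.norm_real, Real.norm_eq_abs]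
  have hfg := two_mul_le_add_sq ‖hat f (ξ - η)‖ ‖hat g η‖
  gcongr
  · exact (abs_nonneg _).trans (hC 0 0)
  · exact hC _ _
  · nlinarith [norm_nonneg (hat f (ξ - η)), norm_nonneg (hat g η)]

theorem memLp_pseudoHat (f g : L2) : MemLp (pseudoHat R f g) 2 volume := by
  obtain ⟨C, hC⟩ := hR.exists_norm_pseudoHat_le f g
  obtain ⟨M, hM⟩ := hR.band
  have hC₀ : 0 ≤ C := (norm_nonneg _).trans (hC 0)
  have hconst : MemLp ((Set.Icc (-M) M).indicator fun _ => C) 2 volume :=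
    memLp_indicator_const 2 measurableSet_Icc C (Or.inr (by simp))
  refine hconst.of_le (hR.aestronglyMeasurable_pseudoHat f g) (ae_of_all _ fun ξ => ?_)
  by_cases hξ : ξ ∈ Set.Icc (-M) M
  · rw [Set.indicator_of_mem hξ, Real.norm_of_nonneg hC₀]
    exact hC ξ
  · have hband (η : ℝ) : R (ξ - η) η = 0 := hM _ _ (by
      rw [sub_add_cancel]
      exact lt_of_not_ge fun h => hξ (abs_le.1 h))
    simp [pseudoHat, hband]

theorem memLp_pow_mul_pseudoHat (k : ℕ) (f g : L2) :
    MemLp (fun ξ : ℝ => (Complex.I * ξ) ^ k * pseudoHat R f g ξ) 2 volume := by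
  have hpow (ξ : ℝ) : (Complex.I * ξ) ^ k * pseudoHat R f g ξ =
      Complex.I ^ k * pseudoHat (fun a b => (a + b) ^ k * R a b) f g ξ := by
    rw [mul_pow, mul_assoc, pseudoHat, pseudoHat, ← integral_const_mul]
    simp only [sub_add_cancel, Complex.ofReal_mul, Complex.ofReal_pow, mul_assoc]
  simp only [hpow]
  exact ((hR.add_pow_mul k).memLp_pseudoHat f g).const_mul _

end IsBandLimited

theorem IsDispersive.isBandLimited_invPhase {p : ℝ → ℝ} {j : ℕ} (hp : IsDispersive p j) {ε : ℝ}
    (hε : 0 < ε) : IsBandLimited (invPhase p ε) where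
  measurable := measurable_invPhase hp.continuous ε
  bounded := hp.exists_abs_invPhase_le hε
  band := ⟨1 / ε, fun _ _ h => Set.indicator_of_notMem (fun hab => h.not_gt hab.2.2.2) _⟩

theorem IsDispersive.isBandLimited_truncMult {p : ℝ → ℝ} {j : ℕ} (hp : IsDispersive p j) {ε : ℝ}
    (hε : 0 < ε) : IsBandLimited (truncMult p ε) := by
  have h := ((hp.isBandLimited_invPhase hε).add_pow_mul 1).const_mul (1 / 2)
  convert h using 3
  rw [truncMult_eq_mul_invPhase]
  ring

/-! ### Removing the truncation -/

theorem ae_frequencies_ne_zero : ∀ᵐ z : ℝ × ℝ, z.1 - z.2 ≠ 0 ∧ z.2 ≠ 0 ∧ z.1 ≠ 0 := by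
  have ne_zero : ∀ᵐ x : ℝ, x ≠ 0 := Measure.ae_ne volume 0
  filter_upwards [Measure.quasiMeasurePreserving_fst.ae ne_zero,
    Measure.quasiMeasurePreserving_snd.ae ne_zero,
    (Measure.quasiMeasurePreserving_fst.comp
      measurePreserving_sub_snd.quasiMeasurePreserving).ae ne_zero] with z h_fst h_snd h_sub
  exact ⟨h_sub, h_snd, h_fst⟩

theorem tendsto_integral_indicator_truncSet {F : ℝ × ℝ → ℂ} (hF : Integrable F) :
    Tendsto (fun ε => ∫ z, ((fun z : ℝ × ℝ => (z.1 - z.2, z.2)) ⁻¹' truncSet ε).indicator F z)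
      (𝓝[>] 0) (𝓝 (∫ z, F z)) := by
  have hmeas (ε : ℝ) : MeasurableSet ((fun z : ℝ × ℝ => (z.1 - z.2, z.2)) ⁻¹' truncSet ε) :=
    measurePreserving_sub_snd.measurable (measurableSet_truncSet ε)
  have hcover : AECover volume (𝓝[>] 0)
      fun ε => (fun z : ℝ × ℝ => (z.1 - z.2, z.2)) ⁻¹' truncSet ε :=
    { ae_eventually_mem := by
        filter_upwards [ae_frequencies_ne_zero] with z ⟨h_sub, h_snd, h_fst⟩
        exact eventually_mem_truncSet h_sub h_snd (by rwa [sub_add_cancel])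
      measurableSet := hmeas }
  simpa only [integral_indicator (hmeas _)] using
    hcover.integral_tendsto_of_countably_generated hF

theorem kernelCubic_eq_indicator {R S : ℝ → ℝ → ℝ} {A : Set (ℝ × ℝ)}
    (h : ∀ a b, R a b = A.indicator (fun z => S z.1 z.2) (a, b)) (v : ℝ → ℂ) :
    kernelCubic R v = ((fun z : ℝ × ℝ => (z.1 - z.2, z.2)) ⁻¹' A).indicator (kernelCubic S v) := by
  classical
  ext z
  rw [kernelCubic, h, Set.indicator_apply, Set.indicator_apply, kernelCubic]
  simp only [Set.mem_preimage]
  split_ifs <;> simp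

theorem tendsto_integral_kernelCubic_truncMult {p : ℝ → ℝ} {v : ℝ → ℂ} {n : ℕ}
    (hint : Integrable (kernelCubic (fun a b => (a + b) ^ n * mult p a b) v)) :
    Tendsto (fun ε => ∫ z, kernelCubic (fun a b => (a + b) ^ n * truncMult p ε a b) v z)
      (𝓝[>] 0) (𝓝 (∫ z, kernelCubic (fun a b => (a + b) ^ n * mult p a b) v z)) := by
  have htrunc (ε a b : ℝ) : (a + b) ^ n * truncMult p ε a b =
      (truncSet ε).indicator (fun z => (z.1 + z.2) ^ n * mult p z.1 z.2) (a, b) := by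
    rw [truncMult_eq_indicator]
    exact (Set.indicator_mul_right (i := (a, b)) _ (fun z : ℝ × ℝ => (z.1 + z.2) ^ n) _).symm
  simp only [fun ε => kernelCubic_eq_indicator
    (S := fun a b => (a + b) ^ n * mult p a b) (htrunc ε) v]
  exact tendsto_integral_indicator_truncSet hint

theorem integral_kernelCubic_truncMult {p : ℝ → ℝ} {j : ℕ} (hp : IsDispersive p j) {v : ℝ → ℂ}
    (hv : Integrable v) (hv₂ : MemLp v 2) (hv_neg : ∀ᵐ ξ, v (-ξ) = conj (v ξ)) (k : ℕ) {ε : ℝ}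
    (hε : 0 < ε) :
    ∫ z, kernelCubic (fun a b => (a + b) ^ (2 * k) * truncMult p ε a b) v z =
      -(1 / 6) * ∫ z, ((fun z : ℝ × ℝ => (z.1 - z.2, z.2)) ⁻¹' truncSet ε).indicator
        (kernelCubic (symMult p k) v) z := by
  have hhalf (z : ℝ × ℝ) : kernelCubic (fun a b => (a + b) ^ (2 * k) * truncMult p ε a b) v z =
      1 / 2 * kernelCubic (fun a b => (a + b) ^ (2 * k + 1) * invPhase p ε a b) v z := by
    simp only [kernelCubic, truncMult_eq_mul_invPhase]
    push_cast
    ring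
  have hsym (a b : ℝ) :
      (a ^ (2 * k + 1) + b ^ (2 * k + 1) - (a + b) ^ (2 * k + 1)) * invPhase p ε a b =
        (truncSet ε).indicator (fun z => symMult p k z.1 z.2) (a, b) :=
    (Set.indicator_mul_right (i := (a, b)) _
      (fun z : ℝ × ℝ => z.1 ^ (2 * k + 1) + z.2 ^ (2 * k + 1) - (z.1 + z.2) ^ (2 * k + 1)) _).symm
  simp only [hhalf]
  rw [integral_const_mul, integral_kernelCubic_add_pow_mul (invPhase_swap p ε)
    (invPhase_rot hp.even ε) hv_neg (odd_two_mul_add_one k)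
    (((hp.isBandLimited_invPhase hε).add_pow_mul _).integrable_kernelCubic hv hv₂),
    kernelCubic_eq_indicator hsym]
  ring

theorem measurable_symMult {p : ℝ → ℝ} (hp : Continuous p) (k : ℕ) :
    Measurable fun z : ℝ × ℝ => symMult p k z.1 z.2 :=
  Measurable.div (by fun_prop) (continuous_phase hp).measurable

section SymmetrizedForm

variable {p : ℝ → ℝ} {v : ℝ → ℂ} {k : ℕ} {C : ℝ}
  (hC : ∀ a b, a ≠ 0 → b ≠ 0 → a + b ≠ 0 → |symMult p k a b| ≤ C * triWeight k a b)

include hC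

theorem ae_norm_kernelCubic_symMult_le :
    ∀ᵐ z : ℝ × ℝ, ‖kernelCubic (symMult p k) v z‖ ≤
      C * (triWeight k (z.1 - z.2) z.2 * ‖cubic v z‖) := by
  filter_upwards [ae_frequencies_ne_zero] with z ⟨h_sub, h_snd, h_fst⟩
  rw [kernelCubic, norm_mul, Complex.norm_real, ← mul_assoc]
  gcongr
  exact hC _ _ h_sub h_snd (by rwa [sub_add_cancel])

theorem integrable_kernelCubic_symMult (hp : Continuous p) (hv : AEStronglyMeasurable v)
    (hv₁ : Integrable fun x => (1 + |x|) * ‖v x‖)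
    (hv₂ : MemLp (fun x => (1 + |x|) ^ k * ‖v x‖) 2) :
    Integrable (kernelCubic (symMult p k) v) := by
  have hmeas : Measurable fun z : ℝ × ℝ => (symMult p k (z.1 - z.2) z.2 : ℂ) :=
    Complex.measurable_ofReal.comp ((measurable_symMult hp k).comp
      ((measurable_fst.sub measurable_snd).prodMk measurable_snd))
  exact ((integrable_triWeight_mul_norm_cubic hv₁ hv₂).const_mul C).mono'
    (hmeas.aestronglyMeasurable.mul (aestronglyMeasurable_cubic hv))
    (ae_norm_kernelCubic_symMult_le hC)

theorem norm_integral_kernelCubic_symMult_le (hC₀ : 0 ≤ C)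
    (hv₁ : Integrable fun x => (1 + |x|) * ‖v x‖)
    (hv₂ : MemLp (fun x => (1 + |x|) ^ k * ‖v x‖) 2) :
    ‖∫ z, kernelCubic (symMult p k) v z‖ ≤
      C * (3 * ((∫ x, (1 + |x|) * ‖v x‖) * ∫ x, ((1 + |x|) ^ k * ‖v x‖) ^ 2)) :=
  calc ‖∫ z, kernelCubic (symMult p k) v z‖
      ≤ ∫ z, C * (triWeight k (z.1 - z.2) z.2 * ‖cubic v z‖) :=
        norm_integral_le_of_norm_le ((integrable_triWeight_mul_norm_cubic hv₁ hv₂).const_mul C)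
          (ae_norm_kernelCubic_symMult_le hC)
    _ ≤ _ := by
        rw [integral_const_mul]
        gcongr
        exact integral_triWeight_mul_norm_cubic_le hv₁ hv₂

end SymmetrizedForm

/-! ### Sobolev norms on the Fourier side -/

theorem norm_pow_mul_hat_sq (k : ℕ) (u : L2) (ξ : ℝ) :
    ‖(Complex.I * ξ) ^ k * hat u ξ‖ ^ 2 = |ξ| ^ (2 * k) * ‖hat u ξ‖ ^ 2 := by
  rw [norm_mul, norm_pow, norm_mul, Complex.norm_I, one_mul, Complex.norm_real, Real.norm_eq_abs,
    mul_pow, ← pow_mul, mul_comm k]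

theorem norm_dx_zero (u : L2) : ‖dx 0 u‖ = ‖u‖ := by
  have hhat : MemLp (fun ξ : ℝ => (Complex.I * ξ) ^ 0 * hat u ξ) 2 volume := by
    simpa only [pow_zero, one_mul] using memLp_hat u
  refine (pow_left_inj₀ (norm_nonneg _) (norm_nonneg _) two_ne_zero).1 ?_
  rw [norm_sq_eq_integral_hat, norm_sq_eq_integral_hat]
  congr 1
  refine integral_congr_ae ?_
  filter_upwards [hat_ofHat hhat] with ξ hξ
  rw [dx, hξ, pow_zero, one_mul]

section Sobolev

variable {k : ℕ} {u : L2}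
  (hu : TemperedDistribution.MemSobolev (k : ℝ) 2 (u : 𝓢'(ℝ, ℂ)))

include hu

theorem memLp_weight_mul_norm_hat : MemLp (fun ξ => (1 + |ξ|) ^ k * ‖hat u ξ‖) 2 volume := by
  have hweight : Continuous fun ξ : ℝ => (1 + |ξ|) ^ k := by fun_prop
  exact (memLp_weight_hat hu).congr_norm (hweight.aestronglyMeasurable.mul (memLp_hat u).1.norm)
    (ae_of_all _ fun ξ => by rw [norm_mul, norm_mul, norm_norm, Complex.norm_real])

theorem memLp_pow_mul_hat : MemLp (fun ξ : ℝ => (Complex.I * ξ) ^ k * hat u ξ) 2 volume := by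
  have hpow : Continuous fun ξ : ℝ => (Complex.I * ξ) ^ k := by fun_prop
  refine (memLp_weight_mul_norm_hat hu).of_le (hpow.aestronglyMeasurable.mul (memLp_hat u).1)
    (ae_of_all _ fun ξ => ?_)
  rw [norm_mul, norm_mul, norm_norm, norm_pow, norm_pow, norm_mul, Complex.norm_I, one_mul,
    Complex.norm_real, Real.norm_eq_abs, Real.norm_of_nonneg (by positivity)]
  gcongr
  exact le_add_of_nonneg_left zero_le_one

theorem integrable_pow_mul_norm_hat_sq : Integrable fun ξ => |ξ| ^ (2 * k) * ‖hat u ξ‖ ^ 2 := by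
  have h := memLp_pow_mul_hat hu
  exact ((memLp_two_iff_integrable_sq_norm h.1).1 h).congr
    (ae_of_all _ (norm_pow_mul_hat_sq k u))

theorem hat_dx : hat (dx k u) =ᵐ[volume] fun ξ => (Complex.I * ξ) ^ k * hat u ξ :=
  hat_ofHat (memLp_pow_mul_hat hu)

theorem norm_dx_sq : ‖dx k u‖ ^ 2 = (2 * Real.pi)⁻¹ * ∫ ξ, |ξ| ^ (2 * k) * ‖hat u ξ‖ ^ 2 := by
  rw [norm_sq_eq_integral_hat]
  congr 1
  refine integral_congr_ae ?_
  filter_upwards [hat_dx hu] with ξ hξ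
  rw [hξ, norm_pow_mul_hat_sq]

theorem integral_weight_mul_norm_hat_sq_le :
    ∫ ξ, ((1 + |ξ|) ^ k * ‖hat u ξ‖) ^ 2 ≤
      4 ^ k * (2 * Real.pi) * (‖u‖ ^ 2 + ‖dx k u‖ ^ 2) := by
  have hweight (ξ : ℝ) : ((1 + |ξ|) ^ k) ^ 2 ≤ 4 ^ k * (1 + |ξ| ^ (2 * k)) :=
    calc ((1 + |ξ|) ^ k) ^ 2 = (1 + |ξ|) ^ (2 * k) := by rw [← pow_mul, mul_comm k]
      _ ≤ 2 ^ (2 * k - 1) * (1 ^ (2 * k) + |ξ| ^ (2 * k)) :=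
        add_pow_le zero_le_one (abs_nonneg ξ) _
      _ ≤ 2 ^ (2 * k) * (1 + |ξ| ^ (2 * k)) := by
        rw [one_pow]
        gcongr
        · exact one_le_two
        · exact Nat.sub_le _ _
      _ = 4 ^ k * (1 + |ξ| ^ (2 * k)) := by
        rw [pow_mul]
        norm_num
  calc ∫ ξ, ((1 + |ξ|) ^ k * ‖hat u ξ‖) ^ 2
      ≤ ∫ ξ, 4 ^ k * (‖hat u ξ‖ ^ 2 + |ξ| ^ (2 * k) * ‖hat u ξ‖ ^ 2) := by
        refine integral_mono (memLp_weight_mul_norm_hat hu).integrable_sq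
          (((integrable_norm_hat_sq u).add (integrable_pow_mul_norm_hat_sq hu)).const_mul _)
          fun ξ => ?_
        rw [mul_pow, ← one_add_mul, ← mul_assoc]
        gcongr
        exact hweight ξ
    _ = 4 ^ k * (2 * Real.pi) * (‖u‖ ^ 2 + ‖dx k u‖ ^ 2) := by
        rw [integral_const_mul, integral_add (integrable_norm_hat_sq u)
          (integrable_pow_mul_norm_hat_sq hu), norm_dx_sq hu, norm_sq_eq_integral_hat u]
        field_simp

theorem memSobolev_of_le {l : ℕ} (hl : l ≤ k) :
    TemperedDistribution.MemSobolev (l : ℝ) 2 (u : 𝓢'(ℝ, ℂ)) :=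
  hu.mono (Nat.cast_le.2 hl)

theorem norm_dx_sq_le {l : ℕ} (hl : l ≤ k) : ‖dx l u‖ ^ 2 ≤ ‖u‖ ^ 2 + ‖dx k u‖ ^ 2 := by
  have hul := memSobolev_of_le hu hl
  have hpow (ξ : ℝ) : |ξ| ^ (2 * l) ≤ 1 + |ξ| ^ (2 * k) := by
    rcases le_total |ξ| 1 with h | h
    · exact (pow_le_one₀ (abs_nonneg ξ) h).trans (le_add_of_nonneg_right (by positivity))
    · exact (pow_le_pow_right₀ h (by omega)).trans (le_add_of_nonneg_left zero_le_one)
  rw [norm_dx_sq hul, norm_dx_sq hu, norm_sq_eq_integral_hat u, ← mul_add,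
    ← integral_add (integrable_norm_hat_sq u) (integrable_pow_mul_norm_hat_sq hu)]
  gcongr ?_ * ?_
  refine integral_mono (integrable_pow_mul_norm_hat_sq hul)
    ((integrable_norm_hat_sq u).add (integrable_pow_mul_norm_hat_sq hu)) fun ξ => ?_
  rw [← one_add_mul]
  gcongr
  exact hpow ξ

end Sobolev

theorem sobolevNorm_sq (N : ℕ) (u : L2) :
    sobolevNorm N u ^ 2 = ∑ k ∈ Finset.range (N + 1), ‖dx k u‖ ^ 2 :=
  Real.sq_sqrt (Finset.sum_nonneg fun _ _ => by positivity)

theorem energyNorm_sq (j N : ℕ) (u : L2) :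
    energyNorm j N u ^ 2 = ‖u‖ ^ 2 + ∑ k ∈ Finset.Icc (2 * j - 1) N, ‖dx k u‖ ^ 2 :=
  Real.sq_sqrt (add_nonneg (by positivity) (Finset.sum_nonneg fun _ _ => by positivity))

theorem add_norm_dx_sq_le_energyNorm_sq {j N k : ℕ} (hk : k ∈ Finset.Icc (2 * j - 1) N) (u : L2) :
    ‖u‖ ^ 2 + ‖dx k u‖ ^ 2 ≤ energyNorm j N u ^ 2 := by
  rw [energyNorm_sq]
  gcongr
  exact Finset.single_le_sum (f := fun k => ‖dx k u‖ ^ 2) (fun _ _ => by positivity) hk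

theorem energyNorm_le_sobolevNorm {j : ℕ} (hj : 1 ≤ j) (N : ℕ) (u : L2) :
    energyNorm j N u ≤ sobolevNorm N u := by
  have hsub : Finset.Icc (2 * j - 1) N ⊆ Finset.Icc 1 N :=
    Finset.Icc_subset_Icc_left (by omega)
  refine Real.sqrt_le_sqrt ?_
  rw [Finset.range_eq_Ico, Finset.sum_eq_sum_Ico_succ_bot N.succ_pos, norm_dx_zero]
  gcongr
  exact hsub

theorem sobolevNorm_le_energyNorm {j N : ℕ} (hN : 2 * j - 1 ≤ N) {u : L2}
    (hu : TemperedDistribution.MemSobolev (N : ℝ) 2 (u : 𝓢'(ℝ, ℂ))) :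
    sobolevNorm N u ≤ (N + 1) * energyNorm j N u := by
  have henergy : 0 ≤ energyNorm j N u := Real.sqrt_nonneg _
  have hlast := add_norm_dx_sq_le_energyNorm_sq (Finset.right_mem_Icc.2 hN) u
  refine le_of_sq_le_sq ?_ (by positivity)
  calc sobolevNorm N u ^ 2 = ∑ k ∈ Finset.range (N + 1), ‖dx k u‖ ^ 2 := sobolevNorm_sq N u
    _ ≤ ∑ _ ∈ Finset.range (N + 1), energyNorm j N u ^ 2 :=
        Finset.sum_le_sum fun k hk =>
          (norm_dx_sq_le hu (Finset.mem_range_succ_iff.1 hk)).trans hlast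
    _ = (N + 1) * energyNorm j N u ^ 2 := by simp
    _ ≤ (N + 1) ^ 2 * energyNorm j N u ^ 2 := by
        gcongr
        exact le_self_pow₀ (by simp) two_ne_zero
    _ = ((N + 1) * energyNorm j N u) ^ 2 := (mul_pow _ _ 2).symm

theorem memLp_inv_one_add_abs : MemLp (fun ξ : ℝ => (1 + |ξ|)⁻¹) 2 volume := by
  have hcont : Continuous fun ξ : ℝ => (1 + |ξ|)⁻¹ :=
    (by fun_prop : Continuous fun ξ : ℝ => 1 + |ξ|).inv₀ fun ξ => by positivity
  rw [memLp_two_iff_integrable_sq hcont.aestronglyMeasurable]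
  refine (integrable_one_add_norm (E := ℝ) (μ := volume) (r := 2) (by simp)).congr
    (ae_of_all _ fun ξ => ?_)
  simp only [Real.norm_eq_abs]
  rw [Real.rpow_neg (by positivity), Real.rpow_two, inv_pow]

theorem inv_mul_one_add_abs_sq_mul (x y : ℝ) :
    (1 + |x|)⁻¹ * ((1 + |x|) ^ 2 * y) = (1 + |x|) * y := by
  field_simp

section OneAddAbs

variable {f : ℝ → ℝ} (hf : MemLp (fun x => (1 + |x|) ^ 2 * f x) 2)

include hf

theorem integrable_one_add_abs_mul : Integrable fun x => (1 + |x|) * f x :=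
  (memLp_inv_one_add_abs.integrable_mul hf).congr
    (ae_of_all _ fun x => inv_mul_one_add_abs_sq_mul x (f x))

theorem integral_one_add_abs_mul_le (hf₀ : 0 ≤ f) :
    ∫ x, (1 + |x|) * f x ≤
      √(∫ x : ℝ, (1 + |x|)⁻¹ ^ 2) * √(∫ x, ((1 + |x|) ^ 2 * f x) ^ 2) := by
  have h := integral_mul_le_Lp_mul_Lq_of_nonneg (μ := volume) Real.HolderConjugate.two_two
    (ae_of_all _ fun x : ℝ => (by positivity : 0 ≤ (1 + |x|)⁻¹))
    (ae_of_all _ fun x => mul_nonneg (by positivity : 0 ≤ (1 + |x|) ^ 2) (hf₀ x))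
    (by simpa using memLp_inv_one_add_abs) (by simpa using hf)
  simpa only [inv_mul_one_add_abs_sq_mul, Real.rpow_two, ← Real.sqrt_eq_rpow] using h

end OneAddAbs

theorem exists_integral_one_add_abs_mul_norm_hat_le :
    ∃ C > 0, ∀ u : L2, TemperedDistribution.MemSobolev ((2 : ℕ) : ℝ) 2 (u : 𝓢'(ℝ, ℂ)) →
      ∫ ξ, (1 + |ξ|) * ‖hat u ξ‖ ≤ C * sobolevNorm 2 u := by
  set D := √(∫ ξ : ℝ, (1 + |ξ|)⁻¹ ^ 2) * √(4 ^ 2 * (2 * Real.pi))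
  refine ⟨D + 1, by positivity, fun u hu => ?_⟩
  have hnorm : ‖u‖ ^ 2 + ‖dx 2 u‖ ^ 2 ≤ sobolevNorm 2 u ^ 2 := by
    rw [sobolevNorm_sq, Finset.sum_range_succ, Finset.sum_range_succ, Finset.sum_range_one,
      norm_dx_zero, add_right_comm]
    exact le_add_of_nonneg_right (by positivity)
  have hnonneg : 0 ≤ sobolevNorm 2 u := Real.sqrt_nonneg _
  calc ∫ ξ, (1 + |ξ|) * ‖hat u ξ‖
      ≤ √(∫ ξ : ℝ, (1 + |ξ|)⁻¹ ^ 2) * √(∫ ξ, ((1 + |ξ|) ^ 2 * ‖hat u ξ‖) ^ 2) :=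
        integral_one_add_abs_mul_le (memLp_weight_mul_norm_hat hu) fun ξ => norm_nonneg _
    _ ≤ √(∫ ξ : ℝ, (1 + |ξ|)⁻¹ ^ 2) * √(4 ^ 2 * (2 * Real.pi) * sobolevNorm 2 u ^ 2) := by
        gcongr
        exact (integral_weight_mul_norm_hat_sq_le hu).trans (by gcongr)
    _ = D * sobolevNorm 2 u := by
        rw [Real.sqrt_mul (by positivity), Real.sqrt_sq hnonneg, ← mul_assoc]
    _ ≤ (D + 1) * sobolevNorm 2 u := by gcongr; exact le_add_of_nonneg_right zero_le_one

/-! ### The modified energies -/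

theorem pow_mul_conj_mul_eq_kernelCubic (μ : ℝ → ℝ → ℝ) (k : ℕ) (v : ℝ → ℂ) (z : ℝ × ℝ) :
    (z.1 : ℂ) ^ (2 * k) * conj (v z.1) * ((μ (z.1 - z.2) z.2 : ℂ) * v (z.1 - z.2) * v z.2) =
      kernelCubic (fun a b => (a + b) ^ (2 * k) * μ a b) v z := by
  rw [kernelCubic, cubic, sub_add_cancel]
  push_cast
  ring

theorem conj_I_mul_pow_mul_I_mul_pow (ξ : ℝ) (k : ℕ) :
    conj ((Complex.I * ξ) ^ k) * (Complex.I * ξ) ^ k = (ξ : ℂ) ^ (2 * k) := by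
  rw [map_pow, ← mul_pow, Complex.conj_mul', norm_mul, Complex.norm_I, one_mul, Complex.norm_real,
    ← Complex.ofReal_pow, Real.norm_eq_abs, sq_abs, Complex.ofReal_pow, pow_mul]

theorem hat_dx_pseudoProd {μ : ℝ → ℝ → ℝ} {k : ℕ} {f g : L2}
    (hB : MemLp (pseudoHat μ f g) 2 volume)
    (hBk : MemLp (fun ξ : ℝ => (Complex.I * ξ) ^ k * pseudoHat μ f g ξ) 2 volume) :
    hat (dx k (pseudoProd μ f g)) =ᵐ[volume] fun ξ => (Complex.I * ξ) ^ k * pseudoHat μ f g ξ := by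
  have hmul : (fun ξ : ℝ => (Complex.I * ξ) ^ k * pseudoHat μ f g ξ) =ᵐ[volume]
      fun ξ => (Complex.I * ξ) ^ k * hat (pseudoProd μ f g) ξ := by
    filter_upwards [hat_ofHat hB] with ξ hξ
    rw [pseudoProd, hξ]
  exact (hat_ofHat (hBk.ae_eq hmul)).trans hmul.symm

theorem energyWith_eq {μ : ℝ → ℝ → ℝ} {k : ℕ} {u : L2}
    (hu : TemperedDistribution.MemSobolev (k : ℝ) 2 (u : 𝓢'(ℝ, ℂ)))
    (hB : MemLp (pseudoHat μ u u) 2 volume)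
    (hBk : MemLp (fun ξ : ℝ => (Complex.I * ξ) ^ k * pseudoHat μ u u ξ) 2 volume)
    (hint : Integrable (kernelCubic (fun a b => (a + b) ^ (2 * k) * μ a b) (hat u))) :
    energyWith μ k u = ‖dx k u‖ ^ 2 +
      Real.pi⁻¹ * (∫ z, kernelCubic (fun a b => (a + b) ^ (2 * k) * μ a b) (hat u) z).re := by
  have hinner : inner ℂ (dx k u) (dx k (pseudoProd μ u u)) = ((2 * Real.pi)⁻¹ : ℝ) *
      ∫ z, kernelCubic (fun a b => (a + b) ^ (2 * k) * μ a b) (hat u) z := by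
    rw [inner_eq_integral_hat, Measure.volume_eq_prod, integral_prod _ hint]
    congr 1
    refine integral_congr_ae ?_
    filter_upwards [hat_dx hu, hat_dx_pseudoProd hB hBk] with ξ hξ hBξ
    simp only [hξ, hBξ, ← pow_mul_conj_mul_eq_kernelCubic, integral_const_mul]
    rw [pseudoHat, map_mul, mul_mul_mul_comm, mul_left_comm, ← conj_I_mul_pow_mul_I_mul_pow]
    ring
  rw [energyWith, hinner, Complex.re_ofReal_mul, ← mul_assoc]
  congr 2
  field_simp

section PrincipalValue

variable {p : ℝ → ℝ} {j N k : ℕ} {u : L2}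

theorem integrable_one_add_abs_mul_norm_hat (hN : 2 ≤ N) (hu : IsRealSobolev N u) :
    Integrable fun ξ => (1 + |ξ|) * ‖hat u ξ‖ :=
  integrable_one_add_abs_mul (memLp_weight_mul_norm_hat (memSobolev_of_le hu.2 hN))

theorem integrable_hat (hN : 2 ≤ N) (hu : IsRealSobolev N u) : Integrable (hat u) :=
  (integrable_one_add_abs_mul_norm_hat hN hu).mono' (memLp_hat u).1 (ae_of_all _ fun ξ =>
    le_mul_of_one_le_left (norm_nonneg _) (le_add_of_nonneg_right (abs_nonneg ξ)))

theorem tendsto_energyWith_of_tendsto_integral (hp : IsDispersive p j) (hN : 2 ≤ N) (hkN : k ≤ N)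
    (hu : IsRealSobolev N u) {L : ℂ}
    (hL : Tendsto
      (fun ε => ∫ z, kernelCubic (fun a b => (a + b) ^ (2 * k) * truncMult p ε a b) (hat u) z)
      (𝓝[>] 0) (𝓝 L)) :
    Tendsto (fun ε => energyWith (truncMult p ε) k u) (𝓝[>] (0 : ℝ))
      (𝓝 (‖dx k u‖ ^ 2 + Real.pi⁻¹ * L.re)) := by
  refine ((((Complex.continuous_re.tendsto L).comp hL).const_mul _).const_add _).congr' ?_
  filter_upwards [self_mem_nhdsWithin] with ε hε
  have hm := hp.isBandLimited_truncMult hε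
  exact (energyWith_eq (memSobolev_of_le hu.2 hkN) (hm.memLp_pseudoHat u u)
    (hm.memLp_pow_mul_pseudoHat k u u)
    ((hm.add_pow_mul _).integrable_kernelCubic (integrable_hat hN hu) (memLp_hat u))).symm

theorem tendsto_energyWith_symMult (hp : IsDispersive p j) (hN : 2 ≤ N) (hjk : j ≤ k) (hkN : k ≤ N)
    (hu : IsRealSobolev N u) :
    Tendsto (fun ε => energyWith (truncMult p ε) k u) (𝓝[>] (0 : ℝ))
      (𝓝 (‖dx k u‖ ^ 2 +
        Real.pi⁻¹ * (-(1 / 6) * ∫ z, kernelCubic (symMult p k) (hat u) z).re)) := by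
  obtain ⟨C, -, hC⟩ := hp.exists_abs_symMult_le hjk
  have hint := integrable_kernelCubic_symMult hC hp.continuous (memLp_hat u).1
    (integrable_one_add_abs_mul_norm_hat hN hu)
    (memLp_weight_mul_norm_hat (memSobolev_of_le hu.2 hkN))
  refine tendsto_energyWith_of_tendsto_integral hp hN hkN hu
    (((tendsto_integral_indicator_truncSet hint).const_mul _).congr' ?_)
  filter_upwards [self_mem_nhdsWithin] with ε hε
  exact (integral_kernelCubic_truncMult hp (integrable_hat hN hu) (memLp_hat u) (hat_neg hu.1)
    k hε).symm

theorem tendsto_energyWith_modifiedEnergy (hp : IsDispersive p j) (hN : 2 ≤ N) (hjk : j ≤ k)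
    (hkN : k ≤ N) (hu : IsRealSobolev N u) :
    Tendsto (fun ε => energyWith (truncMult p ε) k u) (𝓝[>] (0 : ℝ)) (𝓝 (modifiedEnergy p k u)) :=
  tendsto_nhds_limUnder ⟨_, tendsto_energyWith_symMult hp hN hjk hkN hu⟩

theorem ConvergesAbsolutely.modifiedEnergy_eq (hconv : ConvergesAbsolutely p k u)
    (hp : IsDispersive p j) (hN : 2 ≤ N) (hkN : k ≤ N) (hu : IsRealSobolev N u) :
    modifiedEnergy p k u = energyWith (mult p) k u := by
  obtain ⟨hB, hBk, hint⟩ := hconv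
  simp only [pow_mul_conj_mul_eq_kernelCubic (mult p) k (hat u)] at hint
  rw [energyWith_eq (memSobolev_of_le hu.2 hkN) hB hBk hint]
  exact (tendsto_energyWith_of_tendsto_integral hp hN hkN hu
    (tendsto_integral_kernelCubic_truncMult hint)).limUnder_eq

end PrincipalValue

theorem IsDispersive.exists_abs_modifiedEnergy_sub_le {p : ℝ → ℝ} {j k : ℕ}
    (hp : IsDispersive p j) (hjk : j ≤ k) :
    ∃ C > 0, ∀ N ≥ max 2 k, ∀ u : L2, IsRealSobolev N u →
      |modifiedEnergy p k u - ‖dx k u‖ ^ 2| ≤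
        C * sobolevNorm 2 u * (‖u‖ ^ 2 + ‖dx k u‖ ^ 2) := by
  obtain ⟨A, hA₀, hA⟩ := exists_integral_one_add_abs_mul_norm_hat_le
  obtain ⟨C, hC₀, hC⟩ := hp.exists_abs_symMult_le hjk
  refine ⟨C * A * 4 ^ k, by positivity, fun N hN u hu => ?_⟩
  obtain ⟨hN₂, hkN⟩ := max_le_iff.1 hN
  have huk := memSobolev_of_le hu.2 hkN
  have hnonneg : 0 ≤ sobolevNorm 2 u := Real.sqrt_nonneg _
  rw [modifiedEnergy, (tendsto_energyWith_symMult hp hN₂ hjk hkN hu).limUnder_eq,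
    add_sub_cancel_left]
  calc |Real.pi⁻¹ * (-(1 / 6) * ∫ z, kernelCubic (symMult p k) (hat u) z).re|
      ≤ Real.pi⁻¹ * (1 / 6 * ‖∫ z, kernelCubic (symMult p k) (hat u) z‖) := by
        rw [abs_mul, abs_of_pos (inv_pos.2 Real.pi_pos)]
        gcongr
        refine (Complex.abs_re_le_norm _).trans_eq ?_
        rw [norm_mul, norm_neg, norm_div, norm_one, RCLike.norm_ofNat]
    _ ≤ Real.pi⁻¹ * (1 / 6 * (C * (3 *
          ((∫ ξ, (1 + |ξ|) * ‖hat u ξ‖) * ∫ ξ, ((1 + |ξ|) ^ k * ‖hat u ξ‖) ^ 2)))) := by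
        gcongr
        exact norm_integral_kernelCubic_symMult_le hC hC₀.le
          (integrable_one_add_abs_mul_norm_hat hN₂ hu) (memLp_weight_mul_norm_hat huk)
    _ ≤ Real.pi⁻¹ * (1 / 6 * (C * (3 * ((A * sobolevNorm 2 u) *
          (4 ^ k * (2 * Real.pi) * (‖u‖ ^ 2 + ‖dx k u‖ ^ 2)))))) := by
        gcongr
        · exact hA u (memSobolev_of_le hu.2 hN₂)
        · exact integral_weight_mul_norm_hat_sq_le huk
    _ = C * A * 4 ^ k * sobolevNorm 2 u * (‖u‖ ^ 2 + ‖dx k u‖ ^ 2) := by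
        field_simp
        ring

theorem IsDispersive.exists_abs_sum_modifiedEnergy_sub_le {p : ℝ → ℝ} {j N : ℕ}
    (hp : IsDispersive p j) (hN : 2 ≤ N) :
    ∃ C, 0 ≤ C ∧ ∀ u : L2, IsRealSobolev N u →
      |(∑ k ∈ Finset.Icc (2 * j - 1) N, modifiedEnergy p k u) + ‖u‖ ^ 2 - energyNorm j N u ^ 2| ≤
        C * sobolevNorm 2 u * energyNorm j N u ^ 2 := by
  have hterm : ∀ k ∈ Finset.Icc (2 * j - 1) N, ∃ C > 0, ∀ u : L2, IsRealSobolev N u →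
      |modifiedEnergy p k u - ‖dx k u‖ ^ 2| ≤
        C * sobolevNorm 2 u * (‖u‖ ^ 2 + ‖dx k u‖ ^ 2) := fun k hk => by
    obtain ⟨hjk, hkN⟩ := Finset.mem_Icc.1 hk
    obtain ⟨C, hC₀, hC⟩ :=
      hp.exists_abs_modifiedEnergy_sub_le (by have := hp.one_le; omega : j ≤ k)
    exact ⟨C, hC₀, hC N (max_le hN hkN)⟩
  choose! C hC₀ hC using hterm
  refine ⟨∑ k ∈ Finset.Icc (2 * j - 1) N, C k, Finset.sum_nonneg fun k hk => (hC₀ k hk).le,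
    fun u hu => ?_⟩
  have hnonneg : 0 ≤ sobolevNorm 2 u := Real.sqrt_nonneg _
  rw [energyNorm_sq, add_comm (‖u‖ ^ 2), add_sub_add_right_eq_sub, ← Finset.sum_sub_distrib,
    add_comm _ (‖u‖ ^ 2), ← energyNorm_sq, Finset.sum_mul, Finset.sum_mul]
  refine (Finset.abs_sum_le_sum_abs _ _).trans (Finset.sum_le_sum fun k hk => ?_)
  refine (hC k hk u hu).trans ?_
  have hCk := hC₀ k hk
  gcongr
  exact add_norm_dx_sq_le_energyNorm_sq hk u

end Whitham

end

theorem mainTheorem3_general (p : ℝ → ℝ) (j N : ℕ) (hp : Whitham.IsDispersive p j)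
    (hN : max 2 (2 * j - 1) ≤ N) :
    ∃ C > 0, ∀ u : Whitham.L2, Whitham.IsRealSobolev N u →
      (∀ k ∈ Finset.Icc (2 * j - 1) N,
        Tendsto (fun ε => Whitham.energyWith (Whitham.truncMult p ε) k u) (𝓝[>] (0 : ℝ))
          (𝓝 (Whitham.modifiedEnergy p k u)) ∧
        (Whitham.ConvergesAbsolutely p k u →
          Whitham.modifiedEnergy p k u = Whitham.energyWith (Whitham.mult p) k u)) ∧
      |(∑ k ∈ Finset.Icc (2 * j - 1) N, Whitham.modifiedEnergy p k u) + ‖u‖ ^ 2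
          - Whitham.energyNorm j N u ^ 2|
        ≤ C * Whitham.sobolevNorm 2 u * Whitham.energyNorm j N u ^ 2 ∧
      Whitham.energyNorm j N u ≤ Whitham.sobolevNorm N u ∧
      Whitham.sobolevNorm N u ≤ C * Whitham.energyNorm j N u := by
  obtain ⟨hN₂, hjN⟩ := max_le_iff.1 hN
  have hj : 1 ≤ j := hp.one_le
  obtain ⟨C, hC₀, hC⟩ := hp.exists_abs_sum_modifiedEnergy_sub_le hN₂
  refine ⟨C + (N + 1), by positivity, fun u hu => ⟨fun k hk => ?_, ?_,
    Whitham.energyNorm_le_sobolevNorm hj N u, ?_⟩⟩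
  · obtain ⟨hjk, hkN⟩ := Finset.mem_Icc.1 hk
    exact ⟨Whitham.tendsto_energyWith_modifiedEnergy hp hN₂ (by omega) hkN hu,
      fun hconv => hconv.modifiedEnergy_eq hp hN₂ hkN hu⟩
  · have hnonneg : 0 ≤ Whitham.sobolevNorm 2 u := Real.sqrt_nonneg _
    refine (hC u hu).trans ?_
    gcongr
    exact le_add_of_nonneg_right (by positivity)
  · have hnonneg : 0 ≤ Whitham.energyNorm j N u := Real.sqrt_nonneg _
    exact (Whitham.sobolevNorm_le_energyNorm hjN hu.2).trans
      (mul_le_mul_of_nonneg_right (le_add_of_nonneg_left hC₀) hnonneg)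

theorem mainTheorem3 (p : ℝ → ℝ) (α : ℝ) (j N : ℕ)
    (hα : α ∈ Set.Icc (-1 : ℝ) 1) (hα0 : α ≠ 0) (hj : 1 ≤ j)
    (hp : Whitham.IsSymbol p α j) (hN : max 2 (2 * j - 1) ≤ N) :
    ∃ C > 0, ∀ u : Whitham.L2, Whitham.IsRealSobolev N u →
      -- the modified energies are well defined
      (∀ k ∈ Finset.Icc (2 * j - 1) N,
        Tendsto (fun ε => Whitham.energyWith (Whitham.truncMult p ε) k u) (𝓝[>] (0 : ℝ))
          (𝓝 (Whitham.modifiedEnergy p k u)) ∧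
        (Whitham.ConvergesAbsolutely p k u →
          Whitham.modifiedEnergy p k u = Whitham.energyWith (Whitham.mult p) k u)) ∧
      -- their sum is `1 + O(‖u‖_{H²})` times the squared norm of `Hᴺ`
      |(∑ k ∈ Finset.Icc (2 * j - 1) N, Whitham.modifiedEnergy p k u) + ‖u‖ ^ 2
          - Whitham.energyNorm j N u ^ 2|
        ≤ C * Whitham.sobolevNorm 2 u * Whitham.energyNorm j N u ^ 2 ∧
      -- the norm used here is equivalent to the standard one
      Whitham.energyNorm j N u ≤ Whitham.sobolevNorm N u ∧
      Whitham.sobolevNorm N u ≤ C * Whitham.energyNorm j N u :=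
  mainTheorem3_general p j N (hp.isDispersive hα.1 hj) hN
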